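/- Let $p$ be a prime, let $n,m\ge 1$ be integers, let $G$ be a cyclic group of order $p^n$ with a fixed generator $\sigma$, and let $R_m=\mathbb{Z}/p^m\mathbb{Z}$. For $i\ge 0$ put $U_i=1+p^i\mathbb{Z}$ and $-U_i=\{-u : u\in U_i\}$. Use the conventions $p^{-\infty}=0$, $-\infty+j=-\infty$, $-\infty<k$ for every integer $k$, and $\sigma^{p^{-\infty}}x=0$ for every element $x$ of an $R_mG$-module. Let $\mathbf{a}=(a_0,\dots,a_{m-1})\in\{-\infty,0,1,\dots,n\}^m$ and $d\in U_1$, and assume that $d^{p^{a_i}}\in U_{i+1}$ for all $0\le i<m$. Let $X_{\mathbf{a},d,m}$ be the $R_mG$-module with generators $y,x_0,\dots,x_{m-1}$ and relations $$(\sigma-d)y=\sum_{i=0}^{m-1}p^ix_i,\qquad \sigma^{p^{a_i}}x_i=x_i\quad(0\le i<m).$$ (1) If $p$ is odd and $a_i+j<a_{i+j}$ for all $0\le i<m$ and $1\le j<m-i$ with $a_{i+j}\ne-\infty$, then $X_{\mathbf{a},d,m}$ is an indecomposable $R_mG$-module, that is, it is nonzero and is not the direct sum of two nonzero submodules. (2)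 Suppose $p=2$ and the following three conditions hold: - if $n=1$, then $a_0=-\infty$; - $a_i+j<a_{i+j}$ for all $0\le i<m$ and $1\le j<m-i$ with $a_{i+j}\ne-\infty$, except that when $d\notin U_2$ and $a_0=0$, the inequalities with $i=0$ are replaced by the requirement that $a_j\ne 0$ for all $1\le j<m$; - if $m\ge 2$, $a_0=0$, and $d\in -U_v\setminus -U_{v+1}$ for some $v\ge 2$, then $a_i>i-(v-1)$ for all $v\le i<m$ with $a_i\ne-\infty$. Then $X_{\mathbf{a},d,m}$ is an indecomposable $R_mG$-module. -/

import Mathlib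

/-- `p ^ a` for `a ∈ {-∞, 0, 1, 2, …}`, with the convention `p ^ (-∞) = 0`
(the bottom element of `WithBot ℕ` plays the role of `-∞`). -/
def pPow (p : ℕ) : WithBot ℕ → ℕ
  | ⊥ => 0
  | (k : ℕ) => p ^ k

/-- The set `U_i = 1 + p ^ i ℤ`. -/
def U (p i : ℕ) : Set ℤ := {u | ∃ k : ℤ, u = 1 + (p : ℤ) ^ i * k}

/-- The group ring `R_m G`, where `R_m = ℤ / p ^ m`. -/
abbrev RG (p m : ℕ) (G : Type*) : Type _ := MonoidAlgebra (ZMod (p ^ m)) G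

/-- The operator `σ ^ (p ^ a)` in `R_m G`, with the convention that for `a = -∞` it is the zero
operator on every module. -/
noncomputable def sigmaPow (p m : ℕ) {G : Type*} [CommGroup G] (σ : G) : WithBot ℕ → RG p m G
  | ⊥ => 0
  | (k : ℕ) => MonoidAlgebra.of (ZMod (p ^ m)) G (σ ^ p ^ k)

/-- The free `R_m G`-module on the generators `y = (1, 0)` and `x_i = (0, Pi.single i 1)`,
`0 ≤ i < m`. -/
abbrev FreeOnGens (p m : ℕ) (G : Type*) [CommGroup G] : Type _ :=
  RG p m G × (Fin m → RG p m G)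

/-- The generator `y` of the free module. -/
noncomputable def genY (p m : ℕ) (G : Type*) [CommGroup G] : FreeOnGens p m G := (1, 0)

/-- The generator `x_i` of the free module. -/
noncomputable def genX (p m : ℕ) (G : Type*) [CommGroup G] (i : Fin m) : FreeOnGens p m G :=
  (0, Pi.single i 1)

/-- The submodule of relations, generated by `(σ - d) y - ∑ i, p ^ i x_i` and
`σ ^ (p ^ a_i) x_i - x_i`, `0 ≤ i < m`. -/
noncomputable def relations (p m : ℕ) {G : Type*} [CommGroup G] (σ : G)
    (a : Fin m → WithBot ℕ) (d : ℤ) : Submodule (RG p m G) (FreeOnGens p m G) :=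
  Submodule.span (RG p m G)
    (insert
      ((MonoidAlgebra.of (ZMod (p ^ m)) G σ - (d : RG p m G)) • genY p m G
        - ∑ i : Fin m, ((p : RG p m G) ^ (i : ℕ)) • genX p m G i)
      (Set.range fun i : Fin m => sigmaPow p m σ (a i) • genX p m G i - genX p m G i))

/-- The `R_m G`-module `X_{a,d,m}`. -/
abbrev X (p m : ℕ) {G : Type*} [CommGroup G] (σ : G) (a : Fin m → WithBot ℕ) (d : ℤ) : Type _ :=
  FreeOnGens p m G ⧸ relations p m σ a d

/-- A module is indecomposable if it is nonzero and is not the (internal) direct sum of two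
nonzero submodules. -/
def IsIndecomposableModule (A M : Type*) [Ring A] [AddCommGroup M] [Module A M] : Prop :=
  Nontrivial M ∧ ∀ V W : Submodule A M, IsCompl V W → V = ⊥ ∨ W = ⊥

/-! Write an endomorphism `φ` on `y` as `φ y = f(σ) y + ∑ g_i(σ) x_i` with `f, g_i ∈ ℤ[X]`. The
heart is `surjective_of_not_dvd_eval`: if `p ∤ f(1)`, then `φ` is onto. Given a decomposition `V ⊕
W`, the two projections add up to the identity, so their `y`-coefficients can be chosen with sum
`1`. One of them is therefore prime to `p` at `1`, that projection is onto, and the other summand is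
zero.

Surjectivity comes from Nakayama for `J = (p, σ - 1)`, which is generated by nilpotents: all
generators must lie in `N = im φ + J X`. The relation `(σ - d) y = ∑ p^i x_i` puts `x_0` in `J X`.
In `φ x_j` the coefficients of later `x_i` lie in `J` because `a_j < a_i`, earlier `x_i` are handled
by induction, and the diagonal coefficient is congruent to `f(1)` by `dvd_eval_coeff_sub`. For that,
put `T_b = (X^(p^b) - d^(p^b)) / (X - d)` and multiply the first relation by `T_b(σ)`. The gaps
between the `a_i` make all terms on the right divisible by `p^j`, and applying `φ` modulo `p^(j+1)`
links the coordinate at `y` to the one at `x_j`.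

In `φ y` the coefficient of `x_i` (`i > 0`) lies in `J` as soon as `p^(a_i) > p^(a_0) + 1`. The few
remaining indices are treated before `y`, by showing that the `y`-coefficient of `φ x_i` lies in
`J`. -/

open scoped Polynomial

/-! ### Ideals of `ℤ[X]` describing the coefficients. -/

/-- The ideal `(p ^ k, X ^ (p ^ c) - 1)` of `ℤ[X]`. -/
noncomputable def relIdeal (p k c : ℕ) : Ideal ℤ[X] :=
  Ideal.span {Polynomial.C ((p : ℤ) ^ k), Polynomial.X ^ p ^ c - 1}

theorem mem_relIdeal {p k c : ℕ} {f : ℤ[X]} :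
    f ∈ relIdeal p k c ↔
      ∃ u v : ℤ[X], u * Polynomial.C ((p : ℤ) ^ k) + v * (Polynomial.X ^ p ^ c - 1) = f := by
  rw [relIdeal, Ideal.mem_span_pair]

theorem relIdeal_mono {p k k' c c' : ℕ} (hk : k' ≤ k) (hc : c' ≤ c) :
    relIdeal p k c ≤ relIdeal p k' c' := by
  rw [relIdeal, Ideal.span_le, Set.insert_subset_iff, Set.singleton_subset_iff]
  constructor
  · obtain ⟨l, rfl⟩ := Nat.exists_eq_add_of_le hk
    rw [pow_add, map_mul]
    exact Ideal.mul_mem_right _ _ (Ideal.subset_span (by simp))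
  · obtain ⟨l, rfl⟩ := Nat.exists_eq_add_of_le hc
    rw [pow_add, pow_mul]
    obtain ⟨q, hq⟩ := sub_one_dvd_pow_sub_one (Polynomial.X ^ p ^ c' : ℤ[X]) (p ^ l)
    rw [hq]
    exact Ideal.mul_mem_right _ _ (Ideal.subset_span (by simp))

theorem C_pow_mul_mem_relIdeal {p k c : ℕ} (f : ℤ[X]) :
    Polynomial.C ((p : ℤ) ^ k) * f ∈ relIdeal p k c :=
  Ideal.mul_mem_right _ _ (Ideal.subset_span (by simp))

theorem mul_X_pow_sub_one_mem_relIdeal {p k c : ℕ} (f : ℤ[X]) :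
    f * (Polynomial.X ^ p ^ c - 1) ∈ relIdeal p k c :=
  Ideal.mul_mem_left _ _ (Ideal.subset_span (by simp))

theorem C_mem_relIdeal {p k c : ℕ} {z : ℤ} (hz : (p : ℤ) ^ k ∣ z) :
    Polynomial.C z ∈ relIdeal p k c := by
  obtain ⟨w, rfl⟩ := hz
  rw [map_mul]
  exact C_pow_mul_mem_relIdeal _

theorem monic_X_pow_prime_pow_sub_one {p : ℕ} (hp : p.Prime) (c : ℕ) :
    (Polynomial.X ^ p ^ c - 1 : ℤ[X]).Monic := by
  simpa using Polynomial.monic_X_pow_sub_C (1 : ℤ) (pow_pos hp.pos c).ne'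

/-- A monic polynomial stays a non-zero-divisor over `ℤ/z`, even when that ring is not a domain. -/
theorem C_pow_dvd_of_dvd_mul_monic {z : ℤ} {f g : ℤ[X]} (hg : g.Monic)
    (h : Polynomial.C z ∣ f * g) : Polynomial.C z ∣ f := by
  rw [Polynomial.C_dvd_iff_dvd_coeff] at h
  have h0 : (f * g).map (Int.castRingHom (ZMod z.natAbs)) = 0 := by
    ext i
    rw [Polynomial.coeff_map, Polynomial.coeff_zero, eq_intCast, ZMod.intCast_zmod_eq_zero_iff_dvd]
    exact Int.natAbs_dvd.2 (h i)
  rw [Polynomial.map_mul, (hg.map _).mul_left_eq_zero_iff] at h0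
  rw [Polynomial.C_dvd_iff_dvd_coeff]
  intro i
  have := congrArg (fun q => Polynomial.coeff q i) h0
  simp only [Polynomial.coeff_map, Polynomial.coeff_zero, eq_intCast,
    ZMod.intCast_zmod_eq_zero_iff_dvd] at this
  exact Int.natAbs_dvd.1 this

theorem mem_relIdeal_one_of_C_pow_mul_mem {p j c : ℕ} (hp : p.Prime) {f : ℤ[X]}
    (h : Polynomial.C ((p : ℤ) ^ j) * f ∈ relIdeal p (j + 1) c) : f ∈ relIdeal p 1 c := by
  obtain ⟨u, v, huv⟩ := mem_relIdeal.1 h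
  have hp0 : (Polynomial.C ((p : ℤ) ^ j) : ℤ[X]) ≠ 0 := by
    simp [hp.ne_zero]
  have hdvd : Polynomial.C ((p : ℤ) ^ j) ∣ v * (Polynomial.X ^ p ^ c - 1 : ℤ[X]) := by
    refine ⟨f - u * Polynomial.C (p : ℤ), ?_⟩
    rw [pow_succ, map_mul] at huv
    linear_combination huv
  obtain ⟨w, rfl⟩ := C_pow_dvd_of_dvd_mul_monic (monic_X_pow_prime_pow_sub_one hp c) hdvd
  refine mem_relIdeal.2 ⟨u, w, mul_left_cancel₀ hp0 ?_⟩
  rw [← huv, pow_one, pow_succ, map_mul]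
  ring

/-! ### Reduction modulo `p` and order of vanishing at `1`. -/

/-- Reduction modulo `p`, as a ring homomorphism `ℤ[X] →+* (ZMod p)[X]`. -/
noncomputable def modP (p : ℕ) : ℤ[X] →+* (ZMod p)[X] :=
  Polynomial.mapRingHom (Int.castRingHom (ZMod p))

@[simp] theorem modP_X (p : ℕ) : modP p Polynomial.X = Polynomial.X := by simp [modP]

@[simp] theorem modP_C (p : ℕ) (z : ℤ) : modP p (Polynomial.C z) = Polynomial.C (z : ZMod p) := by
  simp [modP]

theorem X_sub_one_dvd_modP_iff {p : ℕ} {f : ℤ[X]} :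
    (Polynomial.X - 1) ∣ modP p f ↔ (p : ℤ) ∣ f.eval 1 := by
  rw [← Polynomial.C_1, Polynomial.dvd_iff_isRoot, Polynomial.IsRoot, modP,
    Polynomial.coe_mapRingHom, Polynomial.eval_one_map, eq_intCast,
    ZMod.intCast_zmod_eq_zero_iff_dvd]

theorem modP_X_pow_sub_one {p : ℕ} (hp : p.Prime) (c : ℕ) :
    modP p (Polynomial.X ^ p ^ c - 1) = (Polynomial.X - 1) ^ p ^ c := by
  have := Fact.mk hp
  rw [map_sub, map_pow, modP_X, map_one, sub_pow_char_pow, one_pow]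

theorem dvd_modP_of_mem_relIdeal {p k c : ℕ} (hp : p.Prime) (hk : k ≠ 0) {f : ℤ[X]}
    (h : f ∈ relIdeal p k c) : (Polynomial.X - 1) ^ p ^ c ∣ modP p f := by
  obtain ⟨u, v, rfl⟩ := mem_relIdeal.1 h
  refine ⟨modP p v, ?_⟩
  rw [map_add, map_mul, map_mul, modP_X_pow_sub_one hp, modP_C]
  simp [hk, mul_comm]

theorem X_sub_one_ne_zero {p : ℕ} (hp : p.Prime) : (Polynomial.X - 1 : (ZMod p)[X]) ≠ 0 := by
  have := Fact.mk hp
  simpa using Polynomial.X_sub_C_ne_zero (1 : ZMod p)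

theorem X_sub_one_dvd_of_pow_dvd {p : ℕ} (hp : p.Prime) {r s : ℕ} (hrs : r < s) {f : (ZMod p)[X]}
    (h : (Polynomial.X - 1) ^ s ∣ (Polynomial.X - 1) ^ r * f) : (Polynomial.X - 1) ∣ f := by
  have := Fact.mk hp
  have h1 : (Polynomial.X - 1 : (ZMod p)[X]) ^ (r + 1) ∣ (Polynomial.X - 1) ^ r * f :=
    (pow_dvd_pow _ hrs).trans h
  rw [pow_succ] at h1
  exact (mul_dvd_mul_iff_left (pow_ne_zero _ (X_sub_one_ne_zero hp))).1 h1

theorem dvd_eval_one_of_mem_relIdeal {p k c : ℕ} {f : ℤ[X]} (h : f ∈ relIdeal p k c) :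
    (p : ℤ) ^ k ∣ f.eval 1 := by
  obtain ⟨u, v, rfl⟩ := mem_relIdeal.1 h
  simp

/-! ### Twisted norms and divisibility of geometric sums. -/

/-- The polynomial `∑ k < N, d ^ (N - 1 - k) X ^ k`, equal to `(X ^ N - d ^ N) / (X - d)`. -/
noncomputable def twistedNorm (d : ℤ) (N : ℕ) : ℤ[X] :=
  ∑ k ∈ Finset.range N, Polynomial.X ^ k * Polynomial.C d ^ (N - 1 - k)

theorem X_sub_C_mul_twistedNorm (d : ℤ) (N : ℕ) :
    (Polynomial.X - Polynomial.C d) * twistedNorm d N = Polynomial.X ^ N - Polynomial.C d ^ N := by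
  rw [mul_comm, twistedNorm]
  exact (Commute.all _ _).geom_sum₂_mul N

theorem modP_C_eq_one {p : ℕ} {d : ℤ} (hd : (p : ℤ) ∣ d - 1) :
    modP p (Polynomial.C d) = 1 := by
  rw [modP_C]
  have : ((d - 1 : ℤ) : ZMod p) = 0 := (ZMod.intCast_zmod_eq_zero_iff_dvd _ _).2 hd
  rw [Int.cast_sub, Int.cast_one, sub_eq_zero] at this
  rw [this, map_one]

theorem modP_twistedNorm {p : ℕ} (hp : p.Prime) {d : ℤ} (hd : (p : ℤ) ∣ d - 1) (b : ℕ) :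
    modP p (twistedNorm d (p ^ b)) = (Polynomial.X - 1) ^ (p ^ b - 1) := by
  have := Fact.mk hp
  have h := congrArg (modP p) (X_sub_C_mul_twistedNorm d (p ^ b))
  rw [map_mul, map_sub, map_sub, map_pow, map_pow, modP_C_eq_one hd, modP_X, one_pow] at h
  apply mul_left_cancel₀ (X_sub_one_ne_zero hp)
  rw [h, ← pow_succ', Nat.sub_add_cancel (Nat.one_le_pow _ _ hp.pos), sub_pow_char_pow, one_pow]

theorem twistedNorm_mul (d : ℤ) (q r : ℕ) :
    twistedNorm d (q * r) =
      twistedNorm d q * ∑ k ∈ Finset.range r,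
        (Polynomial.X ^ q) ^ k * (Polynomial.C d ^ q) ^ (r - 1 - k) := by
  have hne : (Polynomial.X - Polynomial.C d : ℤ[X]) ≠ 0 := Polynomial.X_sub_C_ne_zero d
  apply mul_left_cancel₀ hne
  rw [X_sub_C_mul_twistedNorm, ← mul_assoc, X_sub_C_mul_twistedNorm, mul_comm (_ - _),
    (Commute.all _ _).geom_sum₂_mul, pow_mul, pow_mul]

/-- On an element fixed by `σ^q`, the long norm acts as an integer multiple of the short one; this
integer is where the powers of `p` come from. -/
theorem exists_twistedNorm_sub_mem_span (d : ℤ) (q r : ℕ) :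
    ∃ u : ℤ[X], twistedNorm d (q * r) =
      Polynomial.C (∑ k ∈ Finset.range r, (d ^ q) ^ k) * twistedNorm d q
        + u * (Polynomial.X ^ q - 1) := by
  have h : ∃ u : ℤ[X], ∑ k ∈ Finset.range r,
        (Polynomial.X ^ q) ^ k * (Polynomial.C d ^ q) ^ (r - 1 - k) =
      Polynomial.C (∑ k ∈ Finset.range r, (d ^ q) ^ k) + u * (Polynomial.X ^ q - 1) := by
    choose w hw using fun k : ℕ => sub_one_dvd_pow_sub_one (Polynomial.X ^ q : ℤ[X]) k
    refine ⟨∑ k ∈ Finset.range r, w k * (Polynomial.C d ^ q) ^ (r - 1 - k), ?_⟩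
    rw [← Finset.sum_range_reflect (fun k => (d ^ q) ^ k), map_sum, Finset.sum_mul,
      ← Finset.sum_add_distrib]
    refine Finset.sum_congr rfl fun k _ => ?_
    simp only [map_pow]
    linear_combination (Polynomial.C d ^ q) ^ (r - 1 - k) * hw k
  obtain ⟨u, hu⟩ := h
  refine ⟨twistedNorm d q * u, ?_⟩
  rw [twistedNorm_mul, hu]
  ring

/-- Each lengthening of the sum by a factor `p` contributes a factor made of `p` terms congruent to
`1` modulo `p`. -/
theorem pow_dvd_geom_sum {p : ℕ} {u : ℤ} (hu : (p : ℤ) ∣ u - 1) (r : ℕ) :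
    (p : ℤ) ^ r ∣ ∑ k ∈ Finset.range (p ^ r), u ^ k := by
  by_cases h1 : u = 1
  · simp [h1]
  have h1' : u - 1 ≠ 0 := sub_ne_zero.2 h1
  induction r with
  | zero => simp
  | succ r ih =>
    have hmul : ∑ k ∈ Finset.range (p ^ (r + 1)), u ^ k =
        (∑ k ∈ Finset.range (p ^ r), u ^ k) * ∑ k ∈ Finset.range p, (u ^ p ^ r) ^ k := by
      apply mul_right_cancel₀ h1'
      rw [geom_sum_mul, mul_assoc, mul_comm _ (u - 1), ← mul_assoc, geom_sum_mul, mul_comm,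
        geom_sum_mul, pow_succ, pow_mul]
    rw [hmul, pow_succ]
    refine mul_dvd_mul ih ?_
    have h2 : u ^ p ^ r ≡ 1 [ZMOD p] := by
      simpa using ((Int.modEq_iff_dvd.2 hu).symm.pow (p ^ r))
    have h3 : ∑ k ∈ Finset.range p, (u ^ p ^ r) ^ k ≡ ∑ k ∈ Finset.range p, (1 : ℤ) [ZMOD p] := by
      refine Int.ModEq.sum fun k _ => ?_
      simpa using h2.pow k
    rw [← Int.modEq_zero_iff_dvd]
    refine h3.trans ?_
    simp

/-- Pairing consecutive terms extracts `1 + u`. This sharpens the previous bound when `u ≡ 3` modulo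
`4`, the source of the exceptional case for `p = 2`. -/
theorem mul_two_pow_dvd_geom_sum {u : ℤ} (hu : (2 : ℤ) ∣ u - 1) (r : ℕ) :
    (1 + u) * 2 ^ r ∣ ∑ k ∈ Finset.range (2 ^ (r + 1)), u ^ k := by
  have h : ∀ N : ℕ, ∑ k ∈ Finset.range (2 * N), u ^ k =
      (1 + u) * ∑ k ∈ Finset.range N, (u ^ 2) ^ k := by
    intro N
    induction N with
    | zero => simp
    | succ N ih =>
      rw [mul_add, mul_one, Finset.sum_range_succ, Finset.sum_range_succ, ih,
        Finset.sum_range_succ]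
      ring
  rw [pow_succ', h]
  refine mul_dvd_mul_left _ ?_
  have : ((2 : ℕ) : ℤ) ∣ u ^ 2 - 1 := by
    have := sub_one_dvd_pow_sub_one u 2
    exact_mod_cast hu.trans this
  exact_mod_cast pow_dvd_geom_sum this r

/-! ### Coordinates in the module and the relations among them. -/

section Combination

variable {p m : ℕ} {G : Type*} [CommGroup G]

/-- The ring homomorphism `ℤ[X] →+* R_m G` sending `X` to `σ`. -/
noncomputable def evalAt (p m : ℕ) (σ : G) : ℤ[X] →+* RG p m G :=
  (Polynomial.aeval (MonoidAlgebra.of (ZMod (p ^ m)) G σ)).toRingHom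

theorem evalAt_X (σ : G) : evalAt p m σ Polynomial.X = MonoidAlgebra.of (ZMod (p ^ m)) G σ := by
  simp [evalAt]

theorem evalAt_C (σ : G) (z : ℤ) : evalAt p m σ (Polynomial.C z) = (z : RG p m G) := by
  simp [evalAt]

theorem evalAt_X_pow (σ : G) (k : ℕ) :
    evalAt p m σ (Polynomial.X ^ k) = MonoidAlgebra.of (ZMod (p ^ m)) G (σ ^ k) := by
  rw [map_pow, evalAt_X, map_pow]

theorem prime_pow_eq_zero : ((p : RG p m G)) ^ m = 0 := by
  have h : ((p : ZMod (p ^ m))) ^ m = 0 := by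
    rw [← Nat.cast_pow, ZMod.natCast_self]
  have h2 := congrArg (algebraMap (ZMod (p ^ m)) (RG p m G)) h
  rwa [map_pow, map_natCast, map_zero] at h2

theorem sigma_pow_eq_one {n : ℕ} (hG : Nat.card G = p ^ n) (σ : G) : σ ^ p ^ n = 1 := by
  rw [← hG]
  exact pow_card_eq_one'

theorem evalAt_eq_zero_of_mem {n : ℕ} (hG : Nat.card G = p ^ n) (σ : G) {f : ℤ[X]}
    (hf : f ∈ relIdeal p m n) : evalAt p m σ f = 0 := by
  obtain ⟨u, v, rfl⟩ := mem_relIdeal.1 hf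
  rw [map_add, map_mul, map_mul, map_sub, evalAt_X_pow, sigma_pow_eq_one hG, map_one, map_one,
    sub_self, mul_zero, add_zero, evalAt_C, Int.cast_pow, Int.cast_natCast, prime_pow_eq_zero,
    mul_zero]

theorem evalAt_surjective (hp : p.Prime) {n : ℕ} (hG : Nat.card G = p ^ n) (σ : G)
    (hσ : ∀ g : G, g ∈ Subgroup.zpowers σ) : Function.Surjective (evalAt p m σ) := by
  have : Finite G := Nat.finite_of_card_ne_zero (by rw [hG]; exact (pow_pos hp.pos n).ne')
  have : NeZero (p ^ m) := ⟨(pow_pos hp.pos m).ne'⟩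
  intro r
  induction r using MonoidAlgebra.induction_linear with
  | zero => exact ⟨0, map_zero _⟩
  | add f g hf hg =>
    obtain ⟨a, rfl⟩ := hf
    obtain ⟨b, rfl⟩ := hg
    exact ⟨a + b, map_add _ _ _⟩
  | single g r =>
    obtain ⟨k, rfl⟩ := (mem_powers_iff_mem_zpowers.2 (hσ g))
    refine ⟨Polynomial.C (r.val : ℤ) * Polynomial.X ^ k, ?_⟩
    rw [map_mul, evalAt_X_pow, evalAt_C]
    have : ((r.val : ℤ) : RG p m G) = algebraMap (ZMod (p ^ m)) (RG p m G) r := by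
      conv_rhs => rw [← ZMod.natCast_zmod_val r]
      rw [map_natCast, Int.cast_natCast]
    rw [this, ← Algebra.smul_def]
    simp

/-- The remainder modulo the monic `X^(p^n) - 1` has degree below `p^n`, and the `σ^k` with `k <
p^n` are distinct basis elements, so its coefficients vanish modulo `p^m`. -/
theorem mem_relIdeal_of_evalAt_eq_zero (hp : p.Prime) {n : ℕ} (hG : Nat.card G = p ^ n) (σ : G)
    (hσ : ∀ g : G, g ∈ Subgroup.zpowers σ) {f : ℤ[X]} (hf : evalAt p m σ f = 0) :
    f ∈ relIdeal p m n := by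
  have : Finite G := Nat.finite_of_card_ne_zero (by rw [hG]; exact (pow_pos hp.pos n).ne')
  have hmon := monic_X_pow_prime_pow_sub_one hp n
  have hord : orderOf σ = p ^ n := by
    rw [← hG]; exact orderOf_eq_card_of_forall_mem_zpowers hσ
  set q : ℤ[X] := Polynomial.X ^ p ^ n - 1 with hq
  have hdecomp := Polynomial.modByMonic_add_div f q
  have hr : evalAt p m σ (f %ₘ q) = 0 := by
    have h1 : evalAt p m σ q = 0 :=
      evalAt_eq_zero_of_mem hG σ (by simpa using mul_X_pow_sub_one_mem_relIdeal (p := p) 1)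
    rw [← hdecomp, map_add, map_mul, h1, zero_mul, add_zero] at hf
    exact hf
  have hdeg : (f %ₘ q).natDegree < p ^ n := by
    have hqd : q.natDegree = p ^ n := by
      rw [hq, ← Polynomial.C_1, Polynomial.natDegree_X_pow_sub_C]
    rw [← hqd]
    apply Polynomial.natDegree_modByMonic_lt _ hmon
    intro h1
    rw [h1, Polynomial.natDegree_one] at hqd
    exact (pow_pos hp.pos n).ne hqd
  have hC : Polynomial.C ((p : ℤ) ^ m) ∣ f %ₘ q := by
    rw [Polynomial.C_dvd_iff_dvd_coeff]
    intro i
    by_cases hi : i < p ^ n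
    · rw [Polynomial.as_sum_range' (f %ₘ q) (p ^ n) hdeg, map_sum] at hr
      have h2 : ∀ k ∈ Finset.range (p ^ n),
          evalAt p m σ (Polynomial.monomial k ((f %ₘ q).coeff k)) =
            MonoidAlgebra.single (σ ^ k) (((f %ₘ q).coeff k : ℤ) : ZMod (p ^ m)) := by
        intro k _
        rw [← Polynomial.C_mul_X_pow_eq_monomial, map_mul, evalAt_X_pow, evalAt_C,
          ← zsmul_eq_mul]
        simp
      rw [Finset.sum_congr rfl h2] at hr
      have h3 := congrArg (fun z : RG p m G => z.coeff (σ ^ i)) hr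
      simp only [MonoidAlgebra.coeff_sum, Finsupp.finsetSum_apply,
        MonoidAlgebra.coeff_single, MonoidAlgebra.coeff_zero, Finsupp.coe_zero, Pi.zero_apply] at h3
      rw [Finset.sum_eq_single i] at h3
      · rw [Finsupp.single_eq_same, ZMod.intCast_zmod_eq_zero_iff_dvd] at h3
        exact_mod_cast h3
      · intro k hk hki
        apply Finsupp.single_eq_of_ne
        intro heq
        apply hki
        exact (pow_injOn_Iio_orderOf (by simpa [hord] using hk) (by simpa [hord] using hi)
          heq.symm)
      · intro h; exact absurd (Finset.mem_range.2 hi) h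
    · rw [Polynomial.coeff_eq_zero_of_natDegree_lt (by omega)]
      exact dvd_zero _
  obtain ⟨w, hw⟩ := hC
  rw [← hdecomp, hw, mul_comm q]
  exact Ideal.add_mem _ (C_pow_mul_mem_relIdeal w) (mul_X_pow_sub_one_mem_relIdeal _)

variable (p) (σ : G) (a : Fin m → WithBot ℕ) (d : ℤ)

/-- The combination `f y + ∑ i, g_i x_i` in `X_{a,d,m}`, for integral polynomials in `σ`. -/
noncomputable def comb : ℤ[X] × (Fin m → ℤ[X]) →ₛₗ[evalAt p m σ] X p m σ a d where
  toFun v := (relations p m σ a d).mkQ (evalAt p m σ v.1, fun i => evalAt p m σ (v.2 i))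
  map_add' v w := by
    rw [← map_add]
    congr 1
    ext <;> simp
  map_smul' r v := by
    rw [← map_smul]
    congr 1
    ext <;> simp

/-- The image of the generator `y`. -/
noncomputable def yGen : X p m σ a d := (relations p m σ a d).mkQ (genY p m G)

/-- The image of the generator `x_i`. -/
noncomputable def xGen (i : Fin m) : X p m σ a d := (relations p m σ a d).mkQ (genX p m G i)

theorem comb_apply (v : ℤ[X] × (Fin m → ℤ[X])) :
    comb p σ a d v = evalAt p m σ v.1 • yGen p σ a d + ∑ i, evalAt p m σ (v.2 i) • xGen p σ a d i := by
  simp only [yGen, xGen, ← map_smul, ← map_sum, ← map_add]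
  change (relations p m σ a d).mkQ _ = _
  congr 1
  ext i
  · simp [genY, genX, Prod.fst_sum]
  · simp [genY, genX, Prod.snd_sum, Finset.sum_apply, Pi.single_apply]

theorem comb_surjective (hp : p.Prime) {n : ℕ} (hG : Nat.card G = p ^ n)
    (hσ : ∀ g : G, g ∈ Subgroup.zpowers σ) : Function.Surjective (comb p σ a d) := by
  intro z
  obtain ⟨⟨f, g⟩, rfl⟩ := (relations p m σ a d).mkQ_surjective z
  obtain ⟨f', rfl⟩ := evalAt_surjective (m := m) hp hG σ hσ f
  choose g' hg' using fun i => evalAt_surjective (m := m) hp hG σ hσ (g i)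
  refine ⟨(f', g'), ?_⟩
  change (relations p m σ a d).mkQ _ = _
  simp only [hg']

theorem sigma_sub_smul_yGen :
    evalAt p m σ (Polynomial.X - Polynomial.C d) • yGen p σ a d =
      ∑ i : Fin m, evalAt p m σ (Polynomial.C ((p : ℤ) ^ (i : ℕ))) • xGen p σ a d i := by
  rw [← sub_eq_zero]
  simp only [yGen, xGen, ← map_smul, ← map_sum, ← map_sub]
  rw [Submodule.mkQ_apply, Submodule.Quotient.mk_eq_zero]
  apply Submodule.subset_span
  left
  rw [map_sub, evalAt_X, evalAt_C]
  simp

theorem xGen_eq_zero {i : Fin m} (hi : a i = ⊥) : xGen p σ a d i = 0 := by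
  rw [xGen, Submodule.mkQ_apply, Submodule.Quotient.mk_eq_zero, ← neg_mem_iff]
  apply Submodule.subset_span
  right
  exact ⟨i, by simp [hi, sigmaPow]⟩

theorem X_pow_sub_one_smul_xGen {i : Fin m} {c : ℕ} (hi : a i = c) :
    evalAt p m σ (Polynomial.X ^ p ^ c - 1) • xGen p σ a d i = 0 := by
  rw [xGen, ← map_smul, Submodule.mkQ_apply, Submodule.Quotient.mk_eq_zero]
  apply Submodule.subset_span
  right
  refine ⟨i, ?_⟩
  rw [map_sub, evalAt_X_pow, map_one, sub_smul, one_smul]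
  simp only [hi]
  rfl

/-- A combination in `p ^ k X_{a,d,m}` is, modulo `p ^ k`, a multiple of the first relation. -/
theorem exists_of_comb_eq_pow_smul (hp : p.Prime) {n : ℕ} (hG : Nat.card G = p ^ n)
    (hσ : ∀ g : G, g ∈ Subgroup.zpowers σ) (ha : ∀ i, a i ≤ (n : WithBot ℕ)) {k : ℕ} (hk : k ≤ m)
    {v : ℤ[X] × (Fin m → ℤ[X])} {z : X p m σ a d}
    (hv : comb p σ a d v = evalAt p m σ (Polynomial.C ((p : ℤ) ^ k)) • z) :
    ∃ h : ℤ[X], v.1 - h * (Polynomial.X - Polynomial.C d) ∈ relIdeal p k n ∧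
      ∀ (i : Fin m) (c : ℕ), a i = c →
        v.2 i + Polynomial.C ((p : ℤ) ^ (i : ℕ)) * h ∈ relIdeal p k c := by
  obtain ⟨w, rfl⟩ := comb_surjective p σ a d hp hG hσ z
  rw [← map_smulₛₗ, ← sub_eq_zero, ← map_sub] at hv
  -- Subtracting `p^k` times the coordinates of `z` leaves an honest relation, which is then
  -- expanded in the defining ones; `h` is the multiplier of the first.
  set u := v - Polynomial.C ((p : ℤ) ^ k) • w with hu
  have hu0 : (evalAt p m σ u.1, fun i => evalAt p m σ (u.2 i)) ∈ relations p m σ a d := by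
    rw [← Submodule.Quotient.mk_eq_zero]
    exact hv
  rw [relations, Submodule.mem_span_insert] at hu0
  obtain ⟨r, z, hz, hrz⟩ := hu0
  rw [Submodule.mem_span_range_iff_exists_fun] at hz
  obtain ⟨s, rfl⟩ := hz
  obtain ⟨h, rfl⟩ := evalAt_surjective hp hG σ hσ r
  choose t ht using fun i => evalAt_surjective hp hG σ hσ (s i)
  have h1 := congrArg Prod.fst hrz
  have h2 := fun i => congrFun (congrArg Prod.snd hrz) i
  simp only [genX, genY, Prod.fst_add, Prod.smul_fst, Prod.fst_sub, Prod.fst_sum,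
    Finset.sum_const_zero, sub_zero, add_zero, smul_eq_mul, mul_one, mul_zero] at h1
  refine ⟨h, ?_, fun i c hc => ?_⟩
  · have h3 : u.1 - h * (Polynomial.X - Polynomial.C d) ∈ relIdeal p m n := by
      apply mem_relIdeal_of_evalAt_eq_zero hp hG σ hσ
      rw [map_sub, h1, map_mul, map_sub, evalAt_X, evalAt_C, sub_self]
    have h4 : v.1 - h * (Polynomial.X - Polynomial.C d) =
        (u.1 - h * (Polynomial.X - Polynomial.C d)) + Polynomial.C ((p : ℤ) ^ k) * w.1 := by
      rw [hu, Prod.fst_sub, Prod.smul_fst, smul_eq_mul]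
      ring
    rw [h4]
    exact Ideal.add_mem _ (relIdeal_mono hk le_rfl h3) (C_pow_mul_mem_relIdeal _)
  · have hcn : c ≤ n := by
      have := ha i
      rw [hc] at this
      exact_mod_cast this
    have h3 : u.2 i + Polynomial.C ((p : ℤ) ^ (i : ℕ)) * h - t i * (Polynomial.X ^ p ^ c - 1) ∈
        relIdeal p m n := by
      apply mem_relIdeal_of_evalAt_eq_zero hp hG σ hσ
      have h5 := h2 i
      have h6 : (∑ k : Fin m, (p : RG p m G) ^ (k : ℕ) • (Pi.single k 1 : Fin m → RG p m G)) i =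
          (p : RG p m G) ^ (i : ℕ) := by
        simp [Finset.sum_apply, Pi.single_apply]
      have h7 : (∑ k : Fin m, s k • (sigmaPow p m σ (a k) • Pi.single k 1
          - Pi.single k 1) : Fin m → RG p m G) i = s i * (MonoidAlgebra.of (ZMod (p ^ m)) G (σ ^ p ^ c) - 1) := by
        rw [Finset.sum_apply, Finset.sum_eq_single i]
        · simp only [hc, Pi.smul_apply, Pi.sub_apply, Pi.single_eq_same, smul_eq_mul, mul_one]
          rfl
        · intro k _ hk
          simp [hk.symm]
        · simp
      simp only [genX, genY, Prod.snd_add, Prod.smul_snd, Prod.snd_sub, Prod.snd_sum, smul_zero,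
        zero_sub, Pi.add_apply, Pi.smul_apply, Pi.neg_apply, h6, h7, smul_eq_mul] at h5
      rw [map_sub, map_add, h5, map_mul, map_mul, map_sub, evalAt_X_pow, evalAt_C, map_one, ht i]
      push_cast
      ring
    have h4 : v.2 i + Polynomial.C ((p : ℤ) ^ (i : ℕ)) * h =
        (u.2 i + Polynomial.C ((p : ℤ) ^ (i : ℕ)) * h - t i * (Polynomial.X ^ p ^ c - 1)) +
          t i * (Polynomial.X ^ p ^ c - 1) + Polynomial.C ((p : ℤ) ^ k) * w.2 i := by
      rw [hu, Prod.snd_sub, Prod.smul_snd, Pi.sub_apply, Pi.smul_apply, smul_eq_mul]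
      ring
    rw [h4]
    exact Ideal.add_mem _ (Ideal.add_mem _ (relIdeal_mono hk hcn h3)
      (mul_X_pow_sub_one_mem_relIdeal _)) (C_pow_mul_mem_relIdeal _)

end Combination

/-! ### Endomorphisms read modulo powers of `p`. -/

section Endomorphism

variable {p m : ℕ} {G : Type*} [CommGroup G] {σ : G} {a : Fin m → WithBot ℕ} {d : ℤ}

theorem exists_eq_natCast_of_ne_bot {x : WithBot ℕ} (hx : x ≠ ⊥) : ∃ c : ℕ, x = c := by
  obtain ⟨c, rfl⟩ := WithBot.ne_bot_iff_exists.1 hx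
  exact ⟨c, rfl⟩

theorem pPow_natCast (p c : ℕ) : pPow p (c : WithBot ℕ) = p ^ c := rfl

theorem twistedNorm_zero (d : ℤ) : twistedNorm d 0 = 0 := by simp [twistedNorm]

theorem twistedNorm_one (d : ℤ) : twistedNorm d 1 = 1 := by simp [twistedNorm]

theorem C_dvd_iff_modP_eq_zero {p : ℕ} {f : ℤ[X]} :
    Polynomial.C (p : ℤ) ∣ f ↔ modP p f = 0 := by
  rw [Polynomial.C_dvd_iff_dvd_coeff, Polynomial.ext_iff]
  refine forall_congr' fun i => ?_
  rw [modP, Polynomial.coe_mapRingHom, Polynomial.coeff_map, eq_intCast, Polynomial.coeff_zero,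
    ZMod.intCast_zmod_eq_zero_iff_dvd]

/-- The submodule `p ^ k X_{a,d,m}`. -/
noncomputable def powMul (p k : ℕ) (σ : G) (a : Fin m → WithBot ℕ) (d : ℤ) :
    Submodule (RG p m G) (X p m σ a d) :=
  LinearMap.range (LinearMap.lsmul (RG p m G) (X p m σ a d)
    (evalAt p m σ (Polynomial.C ((p : ℤ) ^ k))))

theorem mem_powMul {k : ℕ} {z : X p m σ a d} :
    z ∈ powMul p k σ a d ↔ ∃ w, z = evalAt p m σ (Polynomial.C ((p : ℤ) ^ k)) • w := by
  simp only [powMul, LinearMap.mem_range, LinearMap.lsmul_apply, eq_comm]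

theorem evalAt_smul_mem_powMul {k : ℕ} {f : ℤ[X]} (hf : Polynomial.C ((p : ℤ) ^ k) ∣ f)
    (z : X p m σ a d) : evalAt p m σ f • z ∈ powMul p k σ a d := by
  obtain ⟨g, rfl⟩ := hf
  exact mem_powMul.2 ⟨evalAt p m σ g • z, by rw [map_mul, mul_smul]⟩

theorem map_mem_powMul (φ : X p m σ a d →ₗ[RG p m G] X p m σ a d) {k : ℕ} {z : X p m σ a d}
    (hz : z ∈ powMul p k σ a d) : φ z ∈ powMul p k σ a d := by
  obtain ⟨w, rfl⟩ := mem_powMul.1 hz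
  exact mem_powMul.2 ⟨φ w, map_smul _ _ _⟩

theorem exists_of_comb_mem_powMul (hp : p.Prime) {n : ℕ} (hG : Nat.card G = p ^ n)
    (hσ : ∀ g : G, g ∈ Subgroup.zpowers σ) (ha : ∀ i, a i ≤ (n : WithBot ℕ)) {k : ℕ} (hk : k ≤ m)
    {v : ℤ[X] × (Fin m → ℤ[X])} (hv : comb p σ a d v ∈ powMul p k σ a d) :
    ∃ h : ℤ[X], v.1 - h * (Polynomial.X - Polynomial.C d) ∈ relIdeal p k n ∧
      ∀ (i : Fin m) (c : ℕ), a i = c →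
        v.2 i + Polynomial.C ((p : ℤ) ^ (i : ℕ)) * h ∈ relIdeal p k c := by
  obtain ⟨w, hw⟩ := mem_powMul.1 hv
  exact exists_of_comb_eq_pow_smul p σ a d hp hG hσ ha hk hw

/-- The coefficients of the relation `(σ ^ (p ^ b) - d ^ (p ^ b)) y = ⋯` modulo `p ^ (j + 1)`. -/
noncomputable def normCoeff (p : ℕ) (a : Fin m → WithBot ℕ) (d : ℤ) (j : Fin m) (b : ℕ)
    (s : Fin m → ℤ) (i : Fin m) : ℤ[X] :=
  if i < j then Polynomial.C ((p : ℤ) ^ (j : ℕ)) * (Polynomial.C (s i) *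
    twistedNorm d (pPow p (a i)))
  else if i = j then Polynomial.C ((p : ℤ) ^ (j : ℕ)) * twistedNorm d (p ^ b) else 0

theorem normCoeff_self (j : Fin m) (b : ℕ) (s : Fin m → ℤ) :
    normCoeff p a d j b s j = Polynomial.C ((p : ℤ) ^ (j : ℕ)) * twistedNorm d (p ^ b) := by
  simp [normCoeff]

theorem normCoeff_of_lt {i j : Fin m} (hij : i < j) (b : ℕ) (s : Fin m → ℤ) :
    normCoeff p a d j b s i = Polynomial.C ((p : ℤ) ^ (j : ℕ)) * (Polynomial.C (s i) *
      twistedNorm d (pPow p (a i))) := by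
  simp [normCoeff, hij]

theorem normCoeff_of_gt {i j : Fin m} (hij : j < i) (b : ℕ) (s : Fin m → ℤ) :
    normCoeff p a d j b s i = 0 := by
  simp [normCoeff, hij.not_gt, hij.ne']

theorem normCoeff_of_bot {i j : Fin m} (hij : i < j) (hi : a i = ⊥) (b : ℕ) (s : Fin m → ℤ) :
    normCoeff p a d j b s i = 0 := by
  simp [normCoeff, hij, hi, pPow, twistedNorm_zero]

theorem C_dvd_normCoeff (j : Fin m) (b : ℕ) (s : Fin m → ℤ) (i : Fin m) :
    Polynomial.C ((p : ℤ) ^ (j : ℕ)) ∣ normCoeff p a d j b s i := by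
  unfold normCoeff
  split_ifs
  · exact dvd_mul_right _ _
  · exact dvd_mul_right _ _
  · exact dvd_zero _

/-- For `i < j` the norm acts on `x_i` as a geometric sum times a shorter norm, and `hs` says that
`p^i` times this sum is `p^j s_i`. The terms with `i > j` already lie in `p^(j+1) X`. -/
theorem twistedNorm_smul_yGen_sub_mem (j : Fin m) (b : ℕ) (s : Fin m → ℤ)
    (hs : ∀ i < j, ∀ c : ℕ, a i = c → c ≤ b ∧
      (p : ℤ) ^ (i : ℕ) * ∑ k ∈ Finset.range (p ^ (b - c)), (d ^ p ^ c) ^ k =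
        (p : ℤ) ^ (j : ℕ) * s i) :
    evalAt p m σ ((Polynomial.X - Polynomial.C d) * twistedNorm d (p ^ b)) • yGen p σ a d
      - ∑ i, evalAt p m σ (normCoeff p a d j b s i) • xGen p σ a d i
        ∈ powMul p (j + 1) σ a d := by
  rw [mul_comm, map_mul, mul_smul, sigma_sub_smul_yGen, Finset.smul_sum, ← Finset.sum_sub_distrib]
  refine Submodule.sum_mem _ fun i _ => ?_
  rw [← mul_smul, ← map_mul, ← sub_smul, ← map_sub]
  rcases lt_trichotomy i j with hij | rfl | hij
  · rw [normCoeff_of_lt hij]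
    rcases eq_or_ne (a i) ⊥ with hai | hai
    · rw [xGen_eq_zero p σ a d hai, smul_zero]
      exact Submodule.zero_mem _
    · obtain ⟨c, hai⟩ := exists_eq_natCast_of_ne_bot hai
      obtain ⟨hcb, hS⟩ := hs i hij c hai
      obtain ⟨u, hu⟩ := exists_twistedNorm_sub_mem_span d (p ^ c) (p ^ (b - c))
      rw [← pow_add, Nat.add_sub_cancel' hcb] at hu
      have hS' := congrArg (Polynomial.C : ℤ → ℤ[X]) hS
      rw [Polynomial.C_mul, Polynomial.C_mul] at hS'
      have h1 : twistedNorm d (p ^ b) * Polynomial.C ((p : ℤ) ^ (i : ℕ)) -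
          Polynomial.C ((p : ℤ) ^ (j : ℕ)) * (Polynomial.C (s i) *
            twistedNorm d (pPow p (a i))) =
          Polynomial.C ((p : ℤ) ^ (i : ℕ)) * u * (Polynomial.X ^ p ^ c - 1) := by
        rw [hai, pPow_natCast]
        linear_combination Polynomial.C ((p : ℤ) ^ (i : ℕ)) * hu + twistedNorm d (p ^ c) * hS'
      rw [h1, map_mul, mul_smul, X_pow_sub_one_smul_xGen p σ a d hai, smul_zero]
      exact Submodule.zero_mem _
  · rw [normCoeff_self, mul_comm, sub_self, map_zero, zero_smul]
    exact Submodule.zero_mem _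
  · rw [normCoeff_of_gt hij, sub_zero]
    apply evalAt_smul_mem_powMul
    exact ((map_dvd Polynomial.C (pow_dvd_pow _ hij))).mul_left _

variable {φ : X p m σ a d →ₗ[RG p m G] X p m σ a d} {v : ℤ[X] × (Fin m → ℤ[X])}
  {w : Fin m → ℤ[X] × (Fin m → ℤ[X])}

theorem exists_coords_of_norm_relation (hp : p.Prime) {n : ℕ} (hG : Nat.card G = p ^ n)
    (hσ : ∀ g : G, g ∈ Subgroup.zpowers σ) (ha : ∀ i, a i ≤ (n : WithBot ℕ))
    (hv : φ (yGen p σ a d) = comb p σ a d v) (hw : ∀ i, φ (xGen p σ a d i) = comb p σ a d (w i))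
    (j : Fin m) (b : ℕ) (s : Fin m → ℤ)
    (hs : ∀ i < j, ∀ c : ℕ, a i = c → c ≤ b ∧
      (p : ℤ) ^ (i : ℕ) * ∑ k ∈ Finset.range (p ^ (b - c)), (d ^ p ^ c) ^ k =
        (p : ℤ) ^ (j : ℕ) * s i) :
    ∃ h : ℤ[X],
      (Polynomial.X - Polynomial.C d) * twistedNorm d (p ^ b) * v.1
        - ∑ i, normCoeff p a d j b s i * (w i).1
        - h * (Polynomial.X - Polynomial.C d) ∈ relIdeal p (j + 1) n ∧
      ∀ (k : Fin m) (c : ℕ), a k = c →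
        (Polynomial.X - Polynomial.C d) * twistedNorm d (p ^ b) * v.2 k
          - ∑ i, normCoeff p a d j b s i * (w i).2 k
          + Polynomial.C ((p : ℤ) ^ (k : ℕ)) * h ∈ relIdeal p (j + 1) c := by
  have h1 := map_mem_powMul φ (twistedNorm_smul_yGen_sub_mem (σ := σ) j b s hs)
  simp only [map_sub, map_sum, map_smul, hv, hw] at h1
  simp only [← map_smulₛₗ, ← map_sum, ← map_sub] at h1
  obtain ⟨h, hh1, hh2⟩ := exists_of_comb_mem_powMul hp hG hσ ha (by omega) h1
  refine ⟨h, ?_, fun k c hc => ?_⟩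
  · simpa [Prod.fst_sum] using hh1
  · simpa [Prod.snd_sum, Finset.sum_apply] using hh2 k c hc

/-- Apply `φ` to `(σ^(p^c) - 1) x_j = 0` and read the `x_i`-coordinate modulo `p`. The unknown
multiple of the first relation enters with factor `p^i`, hence disappears as `i ≠ 0`. -/
theorem dvd_mul_modP_coeff_of_xGen (hp : p.Prime) {n : ℕ} (hG : Nat.card G = p ^ n)
    (hσ : ∀ g : G, g ∈ Subgroup.zpowers σ) (ha : ∀ i, a i ≤ (n : WithBot ℕ))
    (hw : ∀ i, φ (xGen p σ a d i) = comb p σ a d (w i))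
    {i j : Fin m} (hi : (i : ℕ) ≠ 0) {c c' : ℕ} (hj : a j = c) (hi' : a i = c') :
    (Polynomial.X - 1) ^ p ^ c' ∣ (Polynomial.X - 1) ^ p ^ c * modP p ((w j).2 i) := by
  have h0 : comb p σ a d ((Polynomial.X ^ p ^ c - 1 : ℤ[X]) • w j) ∈ powMul p 1 σ a d := by
    rw [map_smulₛₗ, ← hw, ← map_smul, X_pow_sub_one_smul_xGen p σ a d hj, map_zero]
    exact Submodule.zero_mem _
  obtain ⟨h, -, hh⟩ := exists_of_comb_mem_powMul hp hG hσ ha (by omega) h0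
  have h2 := dvd_modP_of_mem_relIdeal hp one_ne_zero (hh i c' hi')
  rw [Prod.smul_snd, Pi.smul_apply, smul_eq_mul, map_add, map_mul, map_mul, modP_X_pow_sub_one hp,
    modP_C] at h2
  simpa [hi] using h2

/-- Modulo `p`, `(σ - 1) y` is `x_0`, which `(σ - 1)^(p^(a_0))` kills. If `a_0 = -∞` then `x_0 = 0`,
in accordance with `pPow p ⊥ = 0`. -/
theorem X_sub_one_pow_smul_yGen_mem (hp : p.Prime) (hd : (p : ℤ) ∣ d - 1) (hm : 0 < m) :
    evalAt p m σ ((Polynomial.X - 1) ^ (pPow p (a ⟨0, hm⟩) + 1)) • yGen p σ a d ∈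
      powMul p 1 σ a d := by
  have h1 : ((Polynomial.X - 1) ^ (pPow p (a ⟨0, hm⟩) + 1) : ℤ[X]) =
      (Polynomial.X - 1) ^ pPow p (a ⟨0, hm⟩) * (Polynomial.X - Polynomial.C d) +
        (Polynomial.X - 1) ^ pPow p (a ⟨0, hm⟩) * Polynomial.C (d - 1) := by
    rw [map_sub, Polynomial.C_1]
    ring
  rw [h1, map_add, add_smul, map_mul, mul_smul, sigma_sub_smul_yGen, Finset.smul_sum]
  refine Submodule.add_mem _ (Submodule.sum_mem _ fun i _ => ?_) (evalAt_smul_mem_powMul ?_ _)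
  · rcases eq_or_ne i ⟨0, hm⟩ with rfl | hi
    · rcases eq_or_ne (a ⟨0, hm⟩) ⊥ with hai | hai
      · rw [xGen_eq_zero p σ a d hai, smul_zero, smul_zero]
        exact Submodule.zero_mem _
      · obtain ⟨c, hai⟩ := exists_eq_natCast_of_ne_bot hai
        have h2 : Polynomial.C ((p : ℤ) ^ 1) ∣
            ((Polynomial.X - 1) ^ p ^ c - (Polynomial.X ^ p ^ c - 1) : ℤ[X]) := by
          rw [pow_one, C_dvd_iff_modP_eq_zero, map_sub, modP_X_pow_sub_one hp]
          simp
        have h3 : ((Polynomial.X - 1) ^ p ^ c : ℤ[X]) =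
            ((Polynomial.X - 1) ^ p ^ c - (Polynomial.X ^ p ^ c - 1)) +
              (Polynomial.X ^ p ^ c - 1) := by ring
        rw [pow_zero, map_one, map_one, one_smul, hai, pPow_natCast, h3, map_add, add_smul,
          X_pow_sub_one_smul_xGen p σ a d hai, add_zero]
        exact evalAt_smul_mem_powMul h2 _
    · rw [← mul_smul, ← map_mul]
      apply evalAt_smul_mem_powMul
      refine (map_dvd Polynomial.C (pow_dvd_pow _ ?_)).mul_left _
      exact Nat.one_le_iff_ne_zero.2 fun h => hi (Fin.ext h)
  · rw [pow_one]
    exact (map_dvd Polynomial.C hd).mul_left _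

theorem dvd_mul_modP_coeff_of_yGen (hp : p.Prime) {n : ℕ} (hG : Nat.card G = p ^ n)
    (hσ : ∀ g : G, g ∈ Subgroup.zpowers σ) (ha : ∀ i, a i ≤ (n : WithBot ℕ))
    (hd : (p : ℤ) ∣ d - 1) (hm : 0 < m) (hv : φ (yGen p σ a d) = comb p σ a d v)
    {i : Fin m} (hi : (i : ℕ) ≠ 0) {c : ℕ} (hi' : a i = c) :
    (Polynomial.X - 1) ^ p ^ c ∣
      (Polynomial.X - 1) ^ (pPow p (a ⟨0, hm⟩) + 1) * modP p (v.2 i) := by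
  have h0 : comb p σ a d ((Polynomial.X - 1 : ℤ[X]) ^ (pPow p (a ⟨0, hm⟩) + 1) • v) ∈
      powMul p 1 σ a d := by
    rw [map_smulₛₗ, ← hv, ← map_smul]
    exact map_mem_powMul φ (X_sub_one_pow_smul_yGen_mem hp hd hm)
  obtain ⟨h, -, hh⟩ := exists_of_comb_mem_powMul hp hG hσ ha (by omega) h0
  have h2 := dvd_modP_of_mem_relIdeal hp one_ne_zero (hh i c hi')
  rw [Prod.smul_snd, Pi.smul_apply, smul_eq_mul, map_add, map_mul, map_mul, map_pow, map_sub,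
    modP_X, map_one, modP_C] at h2
  simpa [hi] using h2

theorem modP_eq_zero_of_C_pow_dvd {j : ℕ} (hj : j ≠ 0) {f : ℤ[X]}
    (hf : Polynomial.C ((p : ℤ) ^ j) ∣ f) : modP p f = 0 := by
  obtain ⟨g, rfl⟩ := hf
  simp [hj]

/-- The diagonal coefficients of an endomorphism at `y` and at `x_j` agree modulo `p`. -/
theorem dvd_eval_coeff_sub (hp : p.Prime) {n : ℕ} (hG : Nat.card G = p ^ n)
    (hσ : ∀ g : G, g ∈ Subgroup.zpowers σ) (ha : ∀ i, a i ≤ (n : WithBot ℕ))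
    (hd : (p : ℤ) ∣ d - 1)
    (hv : φ (yGen p σ a d) = comb p σ a d v) (hw : ∀ i, φ (xGen p σ a d i) = comb p σ a d (w i))
    {j : Fin m} (hj : (j : ℕ) ≠ 0) {c : ℕ} (hjc : a j = c)
    (hdc : (p : ℤ) ^ ((j : ℕ) + 1) ∣ d ^ p ^ c - 1) {b : ℕ} (hbc : b ≤ c) (hbn : b < n)
    {s : Fin m → ℤ}
    (hs : ∀ i < j, ∀ c : ℕ, a i = c → c ≤ b ∧
      (p : ℤ) ^ (i : ℕ) * ∑ k ∈ Finset.range (p ^ (b - c)), (d ^ p ^ c) ^ k =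
        (p : ℤ) ^ (j : ℕ) * s i)
    (hsb : b < c ∨ ∀ i < j, a i ≠ ⊥ → (p : ℤ) ∣ s i) :
    (p : ℤ) ∣ ((w j).2 j - v.1).eval 1 := by
  obtain ⟨h, h1, h2⟩ := exists_coords_of_norm_relation hp hG hσ ha hv hw j b s hs
  have h2 := h2 j c hjc
  have := Fact.mk hp
  have ht := X_sub_one_ne_zero hp
  -- `E = T_c / T_b`: multiplying the `x_j`-coordinate by it turns the coefficient of `v.2 j` into
  -- `X^(p^c) - d^(p^c)`, which dies by `hdc`.
  set E : ℤ[X] := ∑ k ∈ Finset.range (p ^ (c - b)),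
    (Polynomial.X ^ p ^ b) ^ k * (Polynomial.C d ^ p ^ b) ^ (p ^ (c - b) - 1 - k) with hE
  have hTE : twistedNorm d (p ^ c) = twistedNorm d (p ^ b) * E := by
    rw [← twistedNorm_mul, ← pow_add, Nat.add_sub_cancel' hbc]
  have hpb := Nat.one_le_pow b p hp.pos
  have hpbc : p ^ b ≤ p ^ c := Nat.pow_le_pow_right hp.pos hbc
  have hpbn : p ^ b < p ^ n := Nat.pow_lt_pow_right hp.one_lt hbn
  have hEp : modP p E = (Polynomial.X - 1) ^ (p ^ c - p ^ b) := by
    have h3 := congrArg (modP p) hTE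
    rw [map_mul, modP_twistedNorm hp hd, modP_twistedNorm hp hd] at h3
    apply mul_left_cancel₀ (pow_ne_zero (p ^ b - 1) ht)
    rw [← h3, ← pow_add]
    congr 1
    omega
  -- The `y`-coordinate determines `h` modulo `p`; cancelling `X - d ≡ X - 1` costs one power of `X
  -- - 1`.
  have h3 : (Polynomial.X - 1) ^ (p ^ n - 1) ∣
      (Polynomial.X - 1) ^ (p ^ b - 1) * modP p v.1 - modP p h := by
    have h4 := dvd_modP_of_mem_relIdeal hp (Nat.succ_ne_zero _) h1
    have h5 : modP p (∑ i, normCoeff p a d j b s i * (w i).1) = 0 :=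
      modP_eq_zero_of_C_pow_dvd hj
        (Finset.dvd_sum fun i _ => (C_dvd_normCoeff j b s i).mul_right _)
    rw [map_sub, map_sub, h5, sub_zero, map_mul, map_mul, map_mul, modP_twistedNorm hp hd, map_sub,
      modP_X, modP_C_eq_one hd] at h4
    rw [← mul_dvd_mul_iff_left ht, ← pow_succ', Nat.sub_add_cancel (by omega)]
    convert h4 using 1
    ring
  set r : Fin m → ℤ[X] := fun i => if i < j then Polynomial.C (s i) *
    twistedNorm d (pPow p (a i)) else if i = j then twistedNorm d (p ^ b) else 0 with hr
  have hrn : ∀ i, normCoeff p a d j b s i = Polynomial.C ((p : ℤ) ^ (j : ℕ)) * r i := by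
    intro i
    simp only [normCoeff, hr]
    split_ifs <;> simp
  have h4 : ∑ i, r i * E * (w i).2 j - E * h ∈ relIdeal p 1 c := by
    apply mem_relIdeal_one_of_C_pow_mul_mem hp (j := j)
    have h5 : (Polynomial.X ^ p ^ c - Polynomial.C d ^ p ^ c : ℤ[X]) ∈ relIdeal p (j + 1) c := by
      have h6 : (Polynomial.X ^ p ^ c - Polynomial.C d ^ p ^ c : ℤ[X]) =
          1 * (Polynomial.X ^ p ^ c - 1) - Polynomial.C (d ^ p ^ c - 1) := by
        simp
      rw [h6]
      exact Ideal.sub_mem _ (mul_X_pow_sub_one_mem_relIdeal _) (C_mem_relIdeal hdc)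
    rw [← X_sub_C_mul_twistedNorm, hTE] at h5
    have h7 : Polynomial.C ((p : ℤ) ^ (j : ℕ)) * (∑ i, r i * E * (w i).2 j - E * h) =
        v.2 j * ((Polynomial.X - Polynomial.C d) * (twistedNorm d (p ^ b) * E)) -
        E * ((Polynomial.X - Polynomial.C d) * twistedNorm d (p ^ b) * v.2 j
          - ∑ i, normCoeff p a d j b s i * (w i).2 j
          + Polynomial.C ((p : ℤ) ^ (j : ℕ)) * h) := by
      have h8 : E * ∑ i, normCoeff p a d j b s i * (w i).2 j =
          Polynomial.C ((p : ℤ) ^ (j : ℕ)) * ∑ i, r i * E * (w i).2 j := by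
        rw [Finset.mul_sum, Finset.mul_sum]
        refine Finset.sum_congr rfl fun i _ => ?_
        rw [hrn]
        ring
      linear_combination -h8
    rw [h7]
    exact Ideal.sub_mem _ (Ideal.mul_mem_left _ _ h5) (Ideal.mul_mem_left _ _ h2)
  have h5 := dvd_modP_of_mem_relIdeal hp one_ne_zero h4
  have h6 : (Polynomial.X - 1) ^ p ^ c ∣ ∑ i ∈ Finset.univ.erase j,
      modP p (r i * E * (w i).2 j) := by
    refine Finset.dvd_sum fun i hi => ?_
    rcases lt_or_gt_of_ne (Finset.ne_of_mem_erase hi) with hij | hij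
    · have hri : r i = Polynomial.C (s i) * twistedNorm d (pPow p (a i)) := by simp [hr, hij]
      rcases eq_or_ne (a i) ⊥ with hai | hai
      · simp [hri, hai, pPow, twistedNorm_zero]
      · obtain ⟨c', hai⟩ := exists_eq_natCast_of_ne_bot hai
        rw [hri, hai, pPow_natCast]
        rw [map_mul, map_mul, map_mul, modP_twistedNorm hp hd, hEp]
        -- If `b < c`, then `E` supplies at least the one factor `X - 1` missing from the norm of
        -- length `p^(c')`. If not, `s i` vanishes modulo `p`.
        rcases hsb with hb | hb
        · have h7 := dvd_mul_modP_coeff_of_xGen hp hG hσ ha hw hj hai hjc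
          have h8 : p ^ b < p ^ c := Nat.pow_lt_pow_right hp.one_lt hb
          have h9 := Nat.one_le_pow c' p hp.pos
          have h10 : (Polynomial.X - 1 : (ZMod p)[X]) ^ (p ^ c' - 1) *
              (Polynomial.X - 1) ^ (p ^ c - p ^ b) =
              (Polynomial.X - 1) ^ (p ^ c - p ^ b - 1) * (Polynomial.X - 1) ^ p ^ c' := by
            rw [← pow_add, ← pow_add]
            congr 1
            omega
          rw [mul_assoc (modP p _), h10, mul_assoc, mul_assoc]
          exact (h7.mul_left _).mul_left _
        · have h7 : modP p (Polynomial.C (s i)) = 0 := by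
            rw [modP_C, (ZMod.intCast_zmod_eq_zero_iff_dvd _ _).2 (hb i hij (by simp [hai])),
              map_zero]
          rw [h7]
          simp
    · simp [hr, hij.not_gt, hij.ne']
  have hrj : r j = twistedNorm d (p ^ b) := by simp [hr]
  rw [map_sub, map_sum, ← Finset.add_sum_erase _ _ (Finset.mem_univ j), hrj, ← hTE, map_mul,
    map_mul, modP_twistedNorm hp hd] at h5
  -- The hypothesis `b < n` makes the available exponent `p^c - p^b + p^n - 1` at least `p^c`.
  have h7 : (Polynomial.X - 1) ^ p ^ c ∣
      modP p E * ((Polynomial.X - 1) ^ (p ^ b - 1) * modP p v.1 - modP p h) := by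
    have h8 : (Polynomial.X - 1) ^ (p ^ c - p ^ b + (p ^ n - 1)) ∣
      modP p E * ((Polynomial.X - 1) ^ (p ^ b - 1) * modP p v.1 - modP p h) := by
      rw [pow_add, hEp]
      exact mul_dvd_mul_left _ h3
    exact (pow_dvd_pow _ (by omega)).trans h8
  have h8 : modP p E * (Polynomial.X - 1) ^ (p ^ b - 1) = (Polynomial.X - 1) ^ (p ^ c - 1) := by
    rw [hEp, ← pow_add]
    congr 1
    omega
  rw [← X_sub_one_dvd_modP_iff, map_sub]
  apply X_sub_one_dvd_of_pow_dvd hp (r := p ^ c - 1) (s := p ^ c) (by omega)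
  have h9 := dvd_sub (dvd_sub h5 h6) h7
  convert h9 using 1
  linear_combination modP p v.1 * h8

end Endomorphism

/-! ### Indices to be treated before `y`. -/

/-- Modulo `2^(j+1)` one has `d = -1` and `h` is a multiple of `X - 1`, so the relation can be
divided by `X - 1` and then evaluated at `-1`, where `α` drops out and `2^j γ(-1)` remains.
Evaluating without dividing would lose a factor `2`. Finally `γ(1) ≡ γ(-1)` modulo `2`. -/
theorem two_dvd_eval_one_of_relation {j n : ℕ} (hn : 1 ≤ n) {d : ℤ}
    (hd : (2 : ℤ) ^ (j + 1) ∣ 1 + d) {α γ h : ℤ[X]} (hh : (2 : ℤ) ^ (j + 1) ∣ h.eval 1)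
    (hrel : (Polynomial.X - Polynomial.C d) * (Polynomial.X + Polynomial.C d) * α
      - Polynomial.C ((2 : ℤ) ^ j) * (Polynomial.X + Polynomial.C d) * γ
      - h * (Polynomial.X - Polynomial.C d) ∈ relIdeal 2 (j + 1) n) :
    (2 : ℤ) ∣ γ.eval 1 := by
  obtain ⟨e, he⟩ := hd
  obtain rfl : d = 2 ^ (j + 1) * e - 1 := by linarith
  obtain ⟨h', hh'⟩ : (Polynomial.X - 1 : ℤ[X]) ∣ h - Polynomial.C (h.eval 1) := by
    simpa using Polynomial.X_sub_C_dvd_sub_C_eval (a := (1 : ℤ)) (p := h)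
  obtain ⟨f, hf⟩ := hh
  rw [hf] at hh'
  obtain ⟨u, v, huv⟩ := mem_relIdeal.1 hrel
  obtain ⟨N, hN⟩ : ∃ N : ℤ[X], N = ∑ k ∈ Finset.range (2 ^ n), Polynomial.X ^ k := ⟨_, rfl⟩
  have hNX : N * (Polynomial.X - 1) = Polynomial.X ^ 2 ^ n - 1 := by rw [hN, geom_sum_mul]
  have hN1 : N.eval (-1) = 0 := by
    obtain ⟨n, rfl⟩ := Nat.exists_eq_add_of_le' hn
    have h1 := congrArg (Polynomial.eval (-1)) hNX
    have h2 : Even (2 ^ (n + 1)) := by simp [pow_succ]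
    simpa [h2.neg_one_pow] using h1
  rw [← hNX] at huv
  obtain ⟨A, hA⟩ : ∃ A : ℤ[X], (Polynomial.X - 1) *
      ((Polynomial.X + 1) * (α - h') - Polynomial.C ((2 : ℤ) ^ j) * γ - N * v) =
        Polynomial.C ((2 : ℤ) ^ (j + 1)) * A := by
    refine ⟨u + Polynomial.C e * (-2 * α + Polynomial.C (2 ^ (j + 1)) * Polynomial.C e * α
      + Polynomial.C (2 ^ j) * γ - h) + Polynomial.C f * (Polynomial.X + 1), ?_⟩
    push_cast [map_sub, map_mul, map_one] at huv hh' ⊢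
    linear_combination -huv + (Polynomial.X + 1) * hh'
  have hA1 : A.eval 1 = 0 := by
    have h1 := congrArg (Polynomial.eval 1) hA
    simpa using h1
  obtain ⟨B, rfl⟩ : (Polynomial.X - 1 : ℤ[X]) ∣ A := by
    rw [← Polynomial.C_1, Polynomial.dvd_iff_isRoot]
    exact hA1
  have hne : (Polynomial.X - 1 : ℤ[X]) ≠ 0 := by
    simpa using Polynomial.X_sub_C_ne_zero (1 : ℤ)
  have hB : (Polynomial.X + 1) * (α - h') - Polynomial.C ((2 : ℤ) ^ j) * γ - N * v =
      Polynomial.C ((2 : ℤ) ^ (j + 1)) * B := by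
    apply mul_left_cancel₀ hne
    rw [hA]
    ring
  have h2 := congrArg (Polynomial.eval (-1)) hB
  simp only [Polynomial.eval_sub, Polynomial.eval_mul, Polynomial.eval_add, Polynomial.eval_X,
    Polynomial.eval_one, Polynomial.eval_C, hN1, zero_mul, sub_zero, neg_add_cancel,
    zero_sub] at h2
  have h3 : (2 : ℤ) ∣ γ.eval (-1) := by
    refine ⟨-B.eval (-1), ?_⟩
    apply mul_left_cancel₀ (pow_ne_zero j (two_ne_zero (α := ℤ)))
    rw [pow_succ] at h2
    linarith
  have h4 : (1 : ℤ) - (-1) ∣ γ.eval 1 - γ.eval (-1) := Polynomial.sub_dvd_eval_sub _ _ _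
  have h5 : (2 : ℤ) ∣ γ.eval 1 - γ.eval (-1) := by simpa using h4
  simpa using dvd_add h5 h3

section Exceptional

variable {p m : ℕ} {G : Type*} [CommGroup G] {σ : G} {a : Fin m → WithBot ℕ} {d : ℤ}
  {φ : X p m σ a d →ₗ[RG p m G] X p m σ a d} {v : ℤ[X] × (Fin m → ℤ[X])}
  {w : Fin m → ℤ[X] × (Fin m → ℤ[X])}

/-- Here `(σ - d) y ≡ p^j x_j` modulo `p^(j+1)`. After applying `φ`, the `y`-coordinate at `X = 1`
retains only `p^j` times the wanted value, since `d ≡ 1`. -/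
theorem dvd_eval_yCoeff_of_eq_zero (hp : p.Prime) {n : ℕ} (hG : Nat.card G = p ^ n)
    (hσ : ∀ g : G, g ∈ Subgroup.zpowers σ) (ha : ∀ i, a i ≤ (n : WithBot ℕ))
    (hv : φ (yGen p σ a d) = comb p σ a d v) (hw : ∀ i, φ (xGen p σ a d i) = comb p σ a d (w i))
    {j : Fin m} (hdj : (p : ℤ) ^ ((j : ℕ) + 1) ∣ d - 1) (hbot : ∀ i < j, a i = ⊥) :
    (p : ℤ) ∣ (w j).1.eval 1 := by
  obtain ⟨h, h1, -⟩ := exists_coords_of_norm_relation hp hG hσ ha hv hw j 0 0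
    (fun i hi c hc => by simp [hbot i hi] at hc)
  rw [Finset.sum_eq_single j, normCoeff_self, pow_zero, twistedNorm_one] at h1
  · have h2 := dvd_eval_one_of_mem_relIdeal h1
    simp only [Polynomial.eval_sub, Polynomial.eval_mul, Polynomial.eval_X, Polynomial.eval_C, mul_one] at h2
    have h3 : (p : ℤ) ^ ((j : ℕ) + 1) ∣ (p : ℤ) ^ (j : ℕ) * (w j).1.eval 1 := by
      have h4 := dvd_add h2 (hdj.mul_right (v.1.eval 1 - h.eval 1))
      rw [← dvd_neg]
      convert h4 using 1
      ring
    rw [pow_succ] at h3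
    exact (mul_dvd_mul_iff_left (pow_ne_zero _ (by exact_mod_cast hp.ne_zero))).1 h3
  · intro i _ hij
    rcases lt_or_gt_of_ne hij with hij | hij
    · rw [normCoeff_of_bot hij (hbot i hij), zero_mul]
    · rw [normCoeff_of_gt hij, zero_mul]
  · simp

theorem dvd_eval_yCoeff_of_eq_one {n : ℕ} (hn : 1 ≤ n) {φ : X 2 m σ a d →ₗ[RG 2 m G] X 2 m σ a d}
    (hG : Nat.card G = 2 ^ n)
    (hσ : ∀ g : G, g ∈ Subgroup.zpowers σ) (ha : ∀ i, a i ≤ (n : WithBot ℕ))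
    (hv : φ (yGen 2 σ a d) = comb 2 σ a d v) (hw : ∀ i, φ (xGen 2 σ a d i) = comb 2 σ a d (w i))
    {o j : Fin m} (ho : (o : ℕ) = 0) (hoj : o < j) (hao : a o = 0)
    (hdj : (2 : ℤ) ^ ((j : ℕ) + 1) ∣ 1 + d) (hbot : ∀ i, o < i → i < j → a i = ⊥) :
    (2 : ℤ) ∣ (w j).1.eval 1 := by
  obtain ⟨e, he⟩ := hdj
  -- With `b = 1` the norm is `X + d`, acting on `x_0` as `1 + d = 2^j · 2e`; the `x_0`-term thus
  -- vanishes modulo `2^(j+1)`.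
  obtain ⟨h, h1, h2⟩ := exists_coords_of_norm_relation Nat.prime_two hG hσ ha hv hw j 1
    (fun _ => 2 * e) (fun i hi c hc => by
      rcases eq_or_ne i o with rfl | hio
      · have hc0 : c = 0 := by
          rw [hao] at hc
          exact_mod_cast hc.symm
        subst hc0
        refine ⟨zero_le_one, ?_⟩
        simp [ho, Finset.sum_range_succ, he]
        ring
      · have hoi : o < i := lt_of_le_of_ne (by rw [Fin.le_def]; omega) hio.symm
        simp [hbot i hoi hi] at hc)
  have hsum : ∀ f : Fin m → ℤ[X], ∑ i, normCoeff 2 a d j 1 (fun _ => 2 * e) i * f i -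
      Polynomial.C ((2 : ℤ) ^ (j : ℕ)) * (Polynomial.X + Polynomial.C d) * f j =
      Polynomial.C ((2 : ℤ) ^ ((j : ℕ) + 1)) * (Polynomial.C e * f o) := by
    intro f
    rw [← Finset.add_sum_erase _ _ (Finset.mem_univ j),
      Finset.sum_eq_single_of_mem o (Finset.mem_erase.2 ⟨hoj.ne, Finset.mem_univ _⟩),
      normCoeff_self, normCoeff_of_lt hoj, hao]
    · change _ + _ * (_ * twistedNorm d (2 ^ 0)) * _ - _ = _
      simp [twistedNorm, Finset.sum_range_succ]
      ring
    · intro i hi hio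
      rcases lt_or_gt_of_ne (Finset.ne_of_mem_erase hi) with hij | hij
      · have hoi : o < i := lt_of_le_of_ne (by rw [Fin.le_def]; omega) hio.symm
        rw [normCoeff_of_bot hij (hbot i hoi hij), zero_mul]
      · rw [normCoeff_of_gt hij, zero_mul]
  have hT : twistedNorm d (2 ^ 1) = Polynomial.X + Polynomial.C d := by
    simp [twistedNorm, Finset.sum_range_succ]
    ring
  -- Since `a_0 = 0`, the `x_0`-coordinate may be evaluated at `1`, and there `h` occurs with factor
  -- `2^0`.
  have hh : (2 : ℤ) ^ ((j : ℕ) + 1) ∣ h.eval 1 := by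
    have h3 := dvd_eval_one_of_mem_relIdeal (h2 o 0 hao)
    rw [eq_add_of_sub_eq (hsum _), hT, ho] at h3
    simp only [Polynomial.eval_sub, Polynomial.eval_mul, Polynomial.eval_X, Polynomial.eval_C,
      Polynomial.eval_add, he, pow_zero, one_mul] at h3
    push_cast at h3
    obtain ⟨q, hq⟩ := h3
    refine ⟨q - (1 - d) * e * (v.2 o).eval 1 + e * ((w o).2 o).eval 1
      + 2 ^ (j : ℕ) * e * ((w j).2 o).eval 1, ?_⟩
    linear_combination hq
  apply two_dvd_eval_one_of_relation hn ⟨e, he⟩ hh (α := v.1)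
  rw [hT, eq_add_of_sub_eq (hsum _)] at h1
  have h3 := Ideal.add_mem _ h1
    (C_pow_mul_mem_relIdeal (p := 2) (k := (j : ℕ) + 1) (c := n) (Polynomial.C e * (w o).1))
  convert h3 using 1
  push_cast
  ring

end Exceptional

/-! ### Numerical conditions on the exponents. -/

/-- The inequalities between the `a_i` used in the proof of indecomposability. -/
structure GapCondition (p n : ℕ) {m : ℕ} (a : Fin m → WithBot ℕ) (d : ℤ) : Prop where
  gap : ∀ i j : Fin m, (i : ℕ) ≠ 0 → i < j → ∀ c c' : ℕ, a i = c → a j = c' →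
    c + ((j : ℕ) - i) < c'
  gap_zero : ∀ i j : Fin m, (i : ℕ) = 0 → i < j → ∀ c c' : ℕ, a i = c → a j = c' →
    c + (j : ℕ) < c' ∨
      (p = 2 ∧ c = 0 ∧ 1 ≤ c' ∧ 2 ≤ n ∧ (2 : ℤ) ^ ((j : ℕ) + 1) ∣ (1 + d) * 2 ^ (c' - 1))

theorem dvd_pow_sub_one {p : ℕ} {d : ℤ} (hd : (p : ℤ) ∣ d - 1) (k : ℕ) :
    (p : ℤ) ∣ d ^ k - 1 :=
  hd.trans (sub_one_dvd_pow_sub_one d k)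

/-- A genuine gap gives enough powers of `p` by `pow_dvd_geom_sum`; in the alternative with `p = 2`
and `a_0 = 0`, the factor `1 + d` from `mul_two_pow_dvd_geom_sum` makes up the deficit. -/
theorem le_and_pow_dvd_mul_geom_sum {p n m : ℕ} {a : Fin m → WithBot ℕ}
    {d : ℤ} (hd : (p : ℤ) ∣ d - 1) (hgap : GapCondition p n a d) {i j : Fin m} (hij : i < j)
    {c c' : ℕ} (hi : a i = c) (hj : a j = c') {b t : ℕ} (hbt : b + 1 = c' + t) (ht : t ≤ 1)
    (htn : c' < n → t = 1) :
    c ≤ b ∧ (p : ℤ) ^ ((j : ℕ) + t) ∣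
      (p : ℤ) ^ (i : ℕ) * ∑ k ∈ Finset.range (p ^ (b - c)), (d ^ p ^ c) ^ k := by
  have key : c + ((j : ℕ) - i) < c' → c ≤ b ∧ (p : ℤ) ^ ((j : ℕ) + t) ∣
      (p : ℤ) ^ (i : ℕ) * ∑ k ∈ Finset.range (p ^ (b - c)), (d ^ p ^ c) ^ k := by
    intro h
    have hij' : (i : ℕ) < j := hij
    refine ⟨by omega, ?_⟩
    have h1 := mul_dvd_mul_left ((p : ℤ) ^ (i : ℕ))
      (pow_dvd_geom_sum (dvd_pow_sub_one hd (p ^ c)) (b - c))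
    rw [← pow_add] at h1
    exact (pow_dvd_pow _ (by omega)).trans h1
  by_cases hi0 : (i : ℕ) = 0
  · rcases hgap.gap_zero i j hi0 hij c c' hi hj with h | ⟨rfl, rfl, hc', hn, hdvd⟩
    · exact key (by omega)
    · refine ⟨Nat.zero_le _, ?_⟩
      -- Positivity of `b` uses `2 ≤ n`: if `t = 0` then `c' ≥ n ≥ 2`, and if `t = 1` then `b = c' ≥
      -- 1`.
      obtain ⟨b, rfl⟩ : ∃ b', b = b' + 1 := ⟨b - 1, by omega⟩
      have h1 := mul_two_pow_dvd_geom_sum (u := d) (by exact_mod_cast hd) b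
      simp only [hi0, pow_zero, one_mul, pow_one, Nat.sub_zero]
      refine Dvd.dvd.trans ?_ h1
      interval_cases t
      · obtain rfl : c' = b + 1 + 1 := by omega
        rw [Nat.add_sub_cancel, pow_succ, pow_succ, ← mul_assoc] at hdvd
        exact_mod_cast (mul_dvd_mul_iff_right (two_ne_zero (α := ℤ))).1 hdvd
      · obtain rfl : c' = b + 1 := by omega
        exact_mod_cast hdvd
  · exact key (hgap.gap i j hi0 hij c c' hi hj)

theorem exists_norm_exponent {p n m : ℕ} (hn : 1 ≤ n) {a : Fin m → WithBot ℕ}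
    (ha : ∀ i, a i ≤ (n : WithBot ℕ)) {d : ℤ} (hd : (p : ℤ) ∣ d - 1)
    (hgap : GapCondition p n a d) {j : Fin m} {c : ℕ} (hj : a j = c) :
    ∃ (b : ℕ) (s : Fin m → ℤ), b ≤ c ∧ b < n ∧
      (∀ i < j, ∀ c : ℕ, a i = c → c ≤ b ∧
        (p : ℤ) ^ (i : ℕ) * ∑ k ∈ Finset.range (p ^ (b - c)), (d ^ p ^ c) ^ k =
          (p : ℤ) ^ (j : ℕ) * s i) ∧
      (b < c ∨ ∀ i < j, a i ≠ ⊥ → (p : ℤ) ∣ s i) := by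
  have hcn : c ≤ n := by
    have := ha j
    rw [hj] at this
    exact_mod_cast this
  -- The norm exponent must stay below `n`: take `b = c` if `c < n`, with an extra factor `p` in
  -- each `s i`, and `b = c - 1` if `c = n`.
  obtain ⟨b, t, hbt, ht, htn⟩ : ∃ b t, b + 1 = c + t ∧ t ≤ 1 ∧ (c < n ∧ t = 1 ∨ c = n ∧ t = 0) := by
    rcases hcn.lt_or_eq with h | rfl
    · exact ⟨c, 1, rfl, le_rfl, Or.inl ⟨h, rfl⟩⟩
    · exact ⟨c - 1, 0, by omega, by omega, Or.inr ⟨rfl, rfl⟩⟩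
  have key : ∀ i, ∃ s : ℤ, i < j → ∀ c : ℕ, a i = c → c ≤ b ∧
      (p : ℤ) ^ (i : ℕ) * ∑ k ∈ Finset.range (p ^ (b - c)), (d ^ p ^ c) ^ k =
          (p : ℤ) ^ ((j : ℕ) + t) * s := by
    intro i
    rcases eq_or_ne (a i) ⊥ with hai | hai
    · exact ⟨0, fun _ c hc => by simp [hai] at hc⟩
    obtain ⟨c₀, hai⟩ := exists_eq_natCast_of_ne_bot hai
    by_cases hij : i < j
    · obtain ⟨h1, s, hs⟩ := le_and_pow_dvd_mul_geom_sum hd hgap hij hai hj hbt ht (by omega)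
      refine ⟨s, fun _ c' hc' => ?_⟩
      obtain rfl : c₀ = c' := by
        rw [hai] at hc'
        exact_mod_cast hc'
      exact ⟨h1, hs⟩
    · exact ⟨0, fun h => absurd h hij⟩
  choose s hs using key
  refine ⟨b, fun i => (p : ℤ) ^ t * s i, by omega, by omega, fun i hi c hc => ?_, ?_⟩
  · refine ⟨(hs i hi c hc).1, ?_⟩
    rw [(hs i hi c hc).2, pow_add, mul_assoc]
  · rcases htn with ⟨-, rfl⟩ | ⟨-, rfl⟩
    · exact Or.inr fun i _ _ => by simp
    · exact Or.inl (by omega)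

theorem mem_relIdeal_of_dvd_eval_one {p : ℕ} {f : ℤ[X]} (hf : (p : ℤ) ∣ f.eval 1) :
    f ∈ relIdeal p 1 0 := by
  obtain ⟨q, hq⟩ : (Polynomial.X - 1 : ℤ[X]) ∣ f - Polynomial.C (f.eval 1) := by
    simpa using Polynomial.X_sub_C_dvd_sub_C_eval (a := (1 : ℤ)) (p := f)
  have h : f = Polynomial.C (f.eval 1) + q * (Polynomial.X ^ p ^ 0 - 1) := by
    rw [pow_zero, pow_one]
    linear_combination hq
  rw [h]
  exact Ideal.add_mem _ (C_mem_relIdeal (by simpa using hf)) (mul_X_pow_sub_one_mem_relIdeal _)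

/-! ### The ideal `(p, σ - 1)` and Nakayama's lemma. -/

section Radical

variable {p m : ℕ} {G : Type*} [CommGroup G]

/-- The ideal `(p, σ - 1)` of `R_m G`. -/
noncomputable def augIdeal (p m : ℕ) (σ : G) : Ideal (RG p m G) :=
  (relIdeal p 1 0).map (evalAt p m σ)

theorem evalAt_mem_augIdeal {σ : G} {f : ℤ[X]} (hf : (p : ℤ) ∣ f.eval 1) :
    evalAt p m σ f ∈ augIdeal p m σ :=
  Ideal.mem_map_of_mem _ (mem_relIdeal_of_dvd_eval_one hf)

theorem isNilpotent_evalAt_C (σ : G) : IsNilpotent (evalAt p m σ (Polynomial.C (p : ℤ))) :=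
  ⟨m, by rw [evalAt_C, Int.cast_natCast, prime_pow_eq_zero]⟩

theorem isNilpotent_evalAt_X_sub_one (hp : p.Prime) {n : ℕ} (hG : Nat.card G = p ^ n) (σ : G) :
    IsNilpotent (evalAt p m σ (Polynomial.X - 1)) := by
  obtain ⟨u, hu⟩ : Polynomial.C (p : ℤ) ∣
      ((Polynomial.X - 1) ^ p ^ n - (Polynomial.X ^ p ^ n - 1) : ℤ[X]) := by
    rw [C_dvd_iff_modP_eq_zero, map_sub, modP_X_pow_sub_one hp]
    simp
  apply IsNilpotent.of_pow (m := p ^ n)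
  have h0 : evalAt p m σ (Polynomial.X ^ p ^ n - 1) = 0 :=
    evalAt_eq_zero_of_mem hG σ (by simpa using mul_X_pow_sub_one_mem_relIdeal (p := p) 1)
  rw [← map_pow, eq_add_of_sub_eq hu, map_add, map_mul, h0, add_zero]
  exact (Commute.all _ _).isNilpotent_mul_right (isNilpotent_evalAt_C σ)

theorem augIdeal_le_jacobson (hp : p.Prime) {n : ℕ} (hG : Nat.card G = p ^ n) (σ : G) :
    augIdeal p m σ ≤ Ideal.jacobson ⊥ := by
  refine le_trans ?_ (Ideal.radical_le_jacobson (I := ⊥))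
  rw [augIdeal, relIdeal, Ideal.map_span, Ideal.span_le, Set.image_pair, Set.insert_subset_iff,
    Set.singleton_subset_iff]
  constructor
  · rw [pow_one]
    exact mem_nilradical.2 (isNilpotent_evalAt_C σ)
  · rw [pow_zero, pow_one]
    exact mem_nilradical.2 (isNilpotent_evalAt_X_sub_one hp hG σ)

variable {σ : G} {a : Fin m → WithBot ℕ} {d : ℤ}

theorem evalAt_smul_mem_of_dvd {N : Submodule (RG p m G) (X p m σ a d)}
    (hN : augIdeal p m σ • ⊤ ≤ N) {f : ℤ[X]} (hf : (p : ℤ) ∣ f.eval 1) (z : X p m σ a d) :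
    evalAt p m σ f • z ∈ N :=
  hN (Submodule.smul_mem_smul (evalAt_mem_augIdeal hf) trivial)

/-- Modulo `(p, σ - 1)` the element `f(σ)` is the scalar `f(1)`, here invertible modulo `p`. -/
theorem mem_of_evalAt_smul_mem (hp : p.Prime) {N : Submodule (RG p m G) (X p m σ a d)}
    (hN : augIdeal p m σ • ⊤ ≤ N) {f : ℤ[X]} (hf : ¬ (p : ℤ) ∣ f.eval 1) {z : X p m σ a d}
    (hz : evalAt p m σ f • z ∈ N) : z ∈ N := by
  obtain ⟨u, q, huq⟩ := (Nat.prime_iff_prime_int.1 hp).irreducible.coprime_iff_not_dvd.2 hf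
  have h1 : evalAt p m σ (1 - Polynomial.C q * f) • z ∈ N := by
    apply evalAt_smul_mem_of_dvd hN
    refine ⟨u, ?_⟩
    simp only [Polynomial.eval_sub, Polynomial.eval_mul, Polynomial.eval_C, Polynomial.eval_one]
    linear_combination -huq
  have h2 := N.add_mem h1 (N.smul_mem (evalAt p m σ (Polynomial.C q)) hz)
  rwa [← mul_smul, ← map_mul, ← add_smul, ← map_add, sub_add_cancel, map_one, one_smul] at h2

theorem xGen_mem_of_eq_zero (hd : (p : ℤ) ∣ d - 1) {N : Submodule (RG p m G) (X p m σ a d)}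
    (hN : augIdeal p m σ • ⊤ ≤ N) {i : Fin m} (hi : (i : ℕ) = 0) : xGen p σ a d i ∈ N := by
  have h1 := sigma_sub_smul_yGen p σ a d
  rw [← Finset.add_sum_erase _ _ (Finset.mem_univ i), hi, pow_zero, map_one, map_one, one_smul,
    ← sub_eq_iff_eq_add] at h1
  rw [← h1]
  refine Submodule.sub_mem _ (evalAt_smul_mem_of_dvd hN ?_ _)
    (Submodule.sum_mem _ fun k hk => evalAt_smul_mem_of_dvd hN ?_ _)
  · rw [← dvd_neg]
    simpa using hd
  · rw [Polynomial.eval_C]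
    apply dvd_pow_self
    intro hk0
    exact Finset.ne_of_mem_erase hk (Fin.ext (hk0.trans hi.symm))

theorem eq_top_of_gens_mem (hp : p.Prime) {n : ℕ} (hG : Nat.card G = p ^ n)
    (hσ : ∀ g : G, g ∈ Subgroup.zpowers σ) {N : Submodule (RG p m G) (X p m σ a d)}
    (hy : yGen p σ a d ∈ N) (hx : ∀ i, xGen p σ a d i ∈ N) : N = ⊤ := by
  rw [eq_top_iff]
  rintro z -
  obtain ⟨u, rfl⟩ := comb_surjective p σ a d hp hG hσ z
  rw [comb_apply]
  exact N.add_mem (N.smul_mem _ hy) (N.sum_mem fun i _ => N.smul_mem _ (hx i))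

end Radical

/-! ### Surjectivity and indecomposability. -/

section Main

variable {p m : ℕ} {G : Type*} [CommGroup G] {σ : G} {a : Fin m → WithBot ℕ} {d : ℤ}

/-- An endomorphism of `X_{a,d,m}` whose coefficient of `y` at `y` is a unit is surjective. -/
theorem surjective_of_not_dvd_eval (hp : p.Prime) {n : ℕ} (hn : 1 ≤ n) (hm : 0 < m)
    (hG : Nat.card G = p ^ n) (hσ : ∀ g : G, g ∈ Subgroup.zpowers σ)
    (ha : ∀ i, a i ≤ (n : WithBot ℕ)) (hd : (p : ℤ) ∣ d - 1)
    (hda : ∀ (j : Fin m) (c : ℕ), a j = c → (p : ℤ) ^ ((j : ℕ) + 1) ∣ d ^ p ^ c - 1)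
    (hgap : GapCondition p n a d) {φ : X p m σ a d →ₗ[RG p m G] X p m σ a d}
    {v : ℤ[X] × (Fin m → ℤ[X])} (hv : φ (yGen p σ a d) = comb p σ a d v)
    (hv1 : ¬ (p : ℤ) ∣ v.1.eval 1) : Function.Surjective φ := by
  choose w hw' using fun i => comb_surjective p σ a d hp hG hσ (φ (xGen p σ a d i))
  have hw : ∀ i, φ (xGen p σ a d i) = comb p σ a d (w i) := fun i => (hw' i).symm
  obtain ⟨N, hN⟩ : ∃ N, N = LinearMap.range φ ⊔ augIdeal p m σ • ⊤ := ⟨_, rfl⟩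
  have hJN : augIdeal p m σ • ⊤ ≤ N := hN ▸ le_sup_right
  have hφN : ∀ z, φ z ∈ N := fun z =>
    (hN ▸ le_sup_left : LinearMap.range φ ≤ N) (LinearMap.mem_range_self φ z)
  suffices hNtop : N = ⊤ by
    rw [← LinearMap.range_eq_top, eq_top_iff]
    refine Submodule.le_of_le_smul_of_le_jacobson_bot (Module.Finite.fg_top)
      (augIdeal_le_jacobson hp hG σ) ?_
    rw [← hN, hNtop]
  have hx0 : ∀ i : Fin m, (i : ℕ) = 0 ∨ a i = ⊥ → xGen p σ a d i ∈ N := by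
    rintro i (hi | hi)
    · exact xGen_mem_of_eq_zero hd hJN hi
    · rw [xGen_eq_zero p σ a d hi]
      exact N.zero_mem
  have hx : ∀ (j : Fin m) (c : ℕ), (j : ℕ) ≠ 0 → a j = c → (∀ i < j, xGen p σ a d i ∈ N) →
      (yGen p σ a d ∈ N ∨ (p : ℤ) ∣ (w j).1.eval 1) → xGen p σ a d j ∈ N := by
    intro j c hj hjc hlt hy
    have h1 := hφN (xGen p σ a d j)
    rw [hw, comb_apply, ← Finset.add_sum_erase _ _ (Finset.mem_univ j)] at h1
    have h2 : evalAt p m σ (w j).1 • yGen p σ a d ∈ N := by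
      rcases hy with hy | hy
      · exact N.smul_mem _ hy
      · exact evalAt_smul_mem_of_dvd hJN hy _
    have h3 : ∑ i ∈ Finset.univ.erase j, evalAt p m σ ((w j).2 i) • xGen p σ a d i ∈ N := by
      refine N.sum_mem fun i hi => ?_
      rcases lt_or_gt_of_ne (Finset.ne_of_mem_erase hi) with hij | hij
      · exact N.smul_mem _ (hlt i hij)
      · have hi0 : (i : ℕ) ≠ 0 := (Nat.zero_le _).trans_lt (Fin.lt_def.1 hij) |>.ne'
        rcases eq_or_ne (a i) ⊥ with hai | hai
        · exact N.smul_mem _ (hx0 i (Or.inr hai))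
        · obtain ⟨c', hai⟩ := exists_eq_natCast_of_ne_bot hai
          apply evalAt_smul_mem_of_dvd hJN
          rw [← X_sub_one_dvd_modP_iff]
          have h4 := hgap.gap j i hj hij c c' hjc hai
          exact X_sub_one_dvd_of_pow_dvd hp (Nat.pow_lt_pow_right hp.one_lt (by omega))
            (dvd_mul_modP_coeff_of_xGen hp hG hσ ha hw hi0 hjc hai)
    have h4 : evalAt p m σ ((w j).2 j) • xGen p σ a d j ∈ N := by
      have h5 := N.sub_mem (N.sub_mem h1 h2) h3
      rwa [add_sub_cancel_left, add_sub_cancel_right] at h5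
    refine mem_of_evalAt_smul_mem hp hJN ?_ h4
    obtain ⟨b, s, hbc, hbn, hs, hsb⟩ := exists_norm_exponent hn ha hd hgap hjc
    have h5 := dvd_eval_coeff_sub hp hG hσ ha hd hv hw hj hjc (hda j c hjc) hbc hbn hs hsb
    intro h6
    rw [Polynomial.eval_sub] at h5
    exact hv1 ((dvd_sub_right h6).1 h5)
  -- These are the indices whose coefficient in `φ y` is not controlled, so membership of `x_j` must
  -- be obtained without knowing `y ∈ N`.
  have hexc : ∀ (j : Fin m) (c : ℕ), (j : ℕ) ≠ 0 → a j = c → p ^ c ≤ pPow p (a ⟨0, hm⟩) + 1 →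
      xGen p σ a d j ∈ N := by
    intro j c hj hjc hle
    have h0j : (⟨0, hm⟩ : Fin m) < j := Fin.lt_def.2 (Nat.pos_of_ne_zero hj)
    have hc : (c = 0 ∧ a ⟨0, hm⟩ = ⊥) ∨ (c = 1 ∧ a ⟨0, hm⟩ = 0 ∧ p = 2 ∧
        (2 : ℤ) ^ ((j : ℕ) + 1) ∣ 1 + d) := by
      rcases eq_or_ne (a ⟨0, hm⟩) ⊥ with h0 | h0
      · refine Or.inl ⟨?_, h0⟩
        rw [h0] at hle
        by_contra hc
        exact absurd hle (not_le.2 (Nat.one_lt_pow hc hp.one_lt))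
      · obtain ⟨c₀, h0⟩ := exists_eq_natCast_of_ne_bot h0
        rw [h0, pPow_natCast] at hle
        rcases hgap.gap_zero _ j rfl h0j c₀ c h0 hjc with h | ⟨rfl, rfl, hc1, -, hdvd⟩
        · have h1 : p ^ (c₀ + 2) ≤ p ^ c := Nat.pow_le_pow_right hp.pos (by omega)
          have h2 := Nat.one_le_pow c₀ p hp.pos
          have h3 : 2 * 2 ≤ p * p := Nat.mul_le_mul hp.two_le hp.two_le
          rw [pow_add, pow_two] at h1
          nlinarith
        · have hc2 : c = 1 := by
            by_contra hc
            have h1 : 2 ^ 2 ≤ 2 ^ c := Nat.pow_le_pow_right two_pos (by omega)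
            omega
          subst hc2
          exact Or.inr ⟨rfl, h0, rfl, by simpa using hdvd⟩
    -- A finite `a_i` with `0 < i < j` would force `a_j ≥ 2`, whereas `c ≤ 1`.
    have hbot : ∀ i : Fin m, (i : ℕ) ≠ 0 → i < j → a i = ⊥ := by
      intro i hi hij
      by_contra hai
      obtain ⟨c', hai⟩ := exists_eq_natCast_of_ne_bot hai
      have h1 := hgap.gap i j hi hij c' c hai hjc
      have h2 := Fin.lt_def.1 hij
      omega
    refine hx j c hj hjc (fun i hi => hx0 i ?_) (Or.inr ?_)
    · by_cases hi0 : (i : ℕ) = 0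
      · exact Or.inl hi0
      · exact Or.inr (hbot i hi0 hi)
    · rcases hc with ⟨rfl, h0⟩ | ⟨rfl, h0, rfl, hdvd⟩
      · refine dvd_eval_yCoeff_of_eq_zero hp hG hσ ha hv hw (by simpa using hda j 0 hjc) ?_
        intro i hi
        by_cases hi0 : (i : ℕ) = 0
        · rw [← h0]
          exact congrArg a (Fin.ext hi0)
        · exact hbot i hi0 hi
      · exact dvd_eval_yCoeff_of_eq_one hn hG hσ ha hv hw (o := ⟨0, hm⟩) rfl h0j h0 hdvd
          fun i hi hij => hbot i (Fin.lt_def.1 hi).ne' hij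
  have hy : yGen p σ a d ∈ N := by
    have h1 := hφN (yGen p σ a d)
    rw [hv, comb_apply] at h1
    refine mem_of_evalAt_smul_mem hp hJN hv1 ((N.add_mem_iff_left (N.sum_mem fun i _ => ?_)).1 h1)
    by_cases hi : (i : ℕ) = 0 ∨ a i = ⊥
    · exact N.smul_mem _ (hx0 i hi)
    · push Not at hi
      obtain ⟨c, hai⟩ := exists_eq_natCast_of_ne_bot hi.2
      by_cases hle : p ^ c ≤ pPow p (a ⟨0, hm⟩) + 1
      · exact N.smul_mem _ (hexc i c hi.1 hai hle)
      · apply evalAt_smul_mem_of_dvd hJN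
        rw [← X_sub_one_dvd_modP_iff]
        exact X_sub_one_dvd_of_pow_dvd hp (not_le.1 hle)
          (dvd_mul_modP_coeff_of_yGen hp hG hσ ha hd hm hv hi.1 hai)
  refine eq_top_of_gens_mem hp hG hσ hy fun i => ?_
  induction i using WellFoundedLT.induction with
  | ind j ih =>
    by_cases hj : (j : ℕ) = 0 ∨ a j = ⊥
    · exact hx0 j hj
    · push Not at hj
      obtain ⟨c, hjc⟩ := exists_eq_natCast_of_ne_bot hj.2
      exact hx j c hj.1 hjc ih (Or.inl hy)

theorem yGen_eq_comb : yGen p σ a d = comb p σ a d (1, 0) := by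
  simp [comb_apply]

/-- In fact `y ∉ p X`: modulo `p`, the first relation has `y`-coordinate vanishing at `X = 1`. -/
theorem yGen_ne_zero (hp : p.Prime) {n : ℕ} (hm : 0 < m)
    (hG : Nat.card G = p ^ n) (hσ : ∀ g : G, g ∈ Subgroup.zpowers σ)
    (ha : ∀ i, a i ≤ (n : WithBot ℕ)) (hd : (p : ℤ) ∣ d - 1) : yGen p σ a d ≠ 0 := by
  intro h0
  rw [yGen_eq_comb] at h0
  obtain ⟨h, h1, -⟩ := exists_of_comb_mem_powMul hp hG hσ ha (k := 1) hm
    (h0 ▸ Submodule.zero_mem _)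
  have h2 := dvd_eval_one_of_mem_relIdeal h1
  simp only [Polynomial.eval_sub, Polynomial.eval_mul, Polynomial.eval_X, Polynomial.eval_C,
    Polynomial.eval_one, pow_one] at h2
  obtain ⟨q, hq⟩ := h2
  obtain ⟨r, hr⟩ := hd
  have h4 : (p : ℤ) ∣ 1 := ⟨q - h.eval 1 * r, by linear_combination hq - h.eval 1 * hr⟩
  exact (Nat.prime_iff_prime_int.1 hp).not_isUnit (isUnit_of_dvd_one h4)

theorem isIndecomposableModule_of_gapCondition (hp : p.Prime) {n : ℕ} (hn : 1 ≤ n) (hm : 0 < m)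
    (hG : Nat.card G = p ^ n) (hσ : ∀ g : G, g ∈ Subgroup.zpowers σ)
    (ha : ∀ i, a i ≤ (n : WithBot ℕ)) (hd : (p : ℤ) ∣ d - 1)
    (hda : ∀ (j : Fin m) (c : ℕ), a j = c → (p : ℤ) ^ ((j : ℕ) + 1) ∣ d ^ p ^ c - 1)
    (hgap : GapCondition p n a d) : IsIndecomposableModule (RG p m G) (X p m σ a d) := by
  refine ⟨⟨_, 0, yGen_ne_zero hp hm hG hσ ha hd⟩, fun V W hVW => ?_⟩
  have key : ∀ (V W : Submodule (RG p m G) (X p m σ a d)) (hVW : IsCompl V W),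
      ∀ u, V.projection W hVW (yGen p σ a d) = comb p σ a d u → ¬ (p : ℤ) ∣ u.1.eval 1 → W = ⊥ := by
    intro V W hVW u hu hu1
    have hsurj := surjective_of_not_dvd_eval hp hn hm hG hσ ha hd hda hgap hu hu1
    have hV : V = ⊤ := by
      rw [← Submodule.range_projection hVW, LinearMap.range_eq_top.2 hsurj]
    exact eq_bot_of_top_isCompl (hV ▸ hVW)
  obtain ⟨u, hu⟩ := comb_surjective p σ a d hp hG hσ (V.projection W hVW (yGen p σ a d))
  by_cases hu1 : (p : ℤ) ∣ u.1.eval 1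
  · left
    refine key W V hVW.symm ((1, 0) - u) ?_ ?_
    · rw [map_sub, hu, ← yGen_eq_comb, Submodule.projection_eq_self_sub_projection]
    · intro h
      have h4 : (p : ℤ) ∣ 1 := by
        simpa using dvd_add h hu1
      exact (Nat.prime_iff_prime_int.1 hp).not_isUnit (isUnit_of_dvd_one h4)
  · right
    exact key V W hVW u hu.symm hu1

end Main

/-! ### Translation of the hypotheses. -/

theorem mem_U_iff {p i : ℕ} {u : ℤ} : u ∈ U p i ↔ (p : ℤ) ^ i ∣ u - 1 := by
  constructor
  · rintro ⟨k, rfl⟩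
    exact ⟨k, by ring⟩
  · rintro ⟨k, hk⟩
    exact ⟨k, by linarith⟩

/-- Let `v` be the `2`-adic valuation of `1 + d`, at least `2` because `d ≡ 3` modulo `4`. If `v ≤
j`, the hypothesis gives `v + c - 1 ≥ j + 1`; otherwise `v` alone suffices. The value `d = -1` has
no valuation but is trivial. -/
theorem two_pow_dvd_one_add_mul {d : ℤ} (hd : d ∈ U 2 1) (hd2 : d ∉ U 2 2) {j c : ℕ} (hc : 1 ≤ c)
    (h : ∀ v : ℕ, 2 ≤ v → -d ∈ U 2 v → -d ∉ U 2 (v + 1) → v ≤ j → j - (v - 1) < c) :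
    (2 : ℤ) ^ (j + 1) ∣ (1 + d) * 2 ^ (c - 1) := by
  by_cases hd0 : 1 + d = 0
  · simp [hd0]
  have hneg : ∀ v : ℕ, -d ∈ U 2 v ↔ (2 : ℤ) ^ v ∣ 1 + d := by
    intro v
    rw [mem_U_iff, ← dvd_neg]
    push_cast
    ring_nf
  have hfin : FiniteMultiplicity (2 : ℤ) (1 + d) := Int.finiteMultiplicity_iff.2 ⟨by decide, hd0⟩
  obtain ⟨v, hv⟩ : ∃ v, v = multiplicity (2 : ℤ) (1 + d) := ⟨_, rfl⟩
  have h1 : (2 : ℤ) ^ v ∣ 1 + d := hv ▸ pow_multiplicity_dvd _ _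
  have h2 : ¬ (2 : ℤ) ^ (v + 1) ∣ 1 + d :=
    hfin.not_pow_dvd_of_multiplicity_lt (by omega)
  have hv2 : 2 ≤ v := by
    rw [mem_U_iff] at hd hd2
    by_contra hlt
    apply h2
    have h4 : (2 : ℤ) ^ 2 ∣ 1 + d := by
      norm_num at hd hd2 ⊢
      omega
    exact (pow_dvd_pow _ (by omega)).trans h4
  have h5 := mul_dvd_mul_right h1 ((2 : ℤ) ^ (c - 1))
  rw [← pow_add] at h5
  refine (pow_dvd_pow _ ?_).trans h5
  by_cases hvj : v ≤ j
  · have := h v hv2 ((hneg v).2 h1) (fun h => h2 ((hneg _).1 h)) hvj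
    omega
  · omega

theorem theorem1 {p n m : ℕ} (hp : p.Prime) (hn : 1 ≤ n) (hm : 1 ≤ m)
    {G : Type*} [CommGroup G] (hG : Nat.card G = p ^ n)
    (σ : G) (hσ : ∀ g : G, g ∈ Subgroup.zpowers σ)
    (a : Fin m → WithBot ℕ) (ha : ∀ i, a i ≤ (n : WithBot ℕ))
    (d : ℤ) (hd : d ∈ U p 1)
    (hda : ∀ i : Fin m, d ^ pPow p (a i) ∈ U p ((i : ℕ) + 1)) :
    (Odd p →
      (∀ (i j : ℕ) (hij : i + j < m), 1 ≤ j → a ⟨i + j, hij⟩ ≠ ⊥ →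
        a ⟨i, by omega⟩ + (j : WithBot ℕ) < a ⟨i + j, hij⟩) →
      IsIndecomposableModule (RG p m G) (X p m σ a d)) ∧
    (p = 2 →
      (n = 1 → a ⟨0, hm⟩ = ⊥) →
      (∀ (i j : ℕ) (hij : i + j < m), 1 ≤ j → a ⟨i + j, hij⟩ ≠ ⊥ →
        ¬ (d ∉ U 2 2 ∧ i = 0 ∧ a ⟨i, by omega⟩ = 0) →
        a ⟨i, by omega⟩ + (j : WithBot ℕ) < a ⟨i + j, hij⟩) →
      (d ∉ U 2 2 → a ⟨0, hm⟩ = 0 → ∀ (j : ℕ) (hj : j < m), 1 ≤ j → a ⟨j, hj⟩ ≠ 0) →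
      (2 ≤ m → a ⟨0, hm⟩ = 0 →
        ∀ v : ℕ, 2 ≤ v → -d ∈ U 2 v → -d ∉ U 2 (v + 1) →
          ∀ (i : ℕ) (hi : i < m), v ≤ i → a ⟨i, hi⟩ ≠ ⊥ →
            ((i - (v - 1) : ℕ) : WithBot ℕ) < a ⟨i, hi⟩) →
      IsIndecomposableModule (RG p m G) (X p m σ a d)) := by
  have hd' : (p : ℤ) ∣ d - 1 := by simpa using mem_U_iff.1 hd
  have hda' : ∀ (j : Fin m) (c : ℕ), a j = c → (p : ℤ) ^ ((j : ℕ) + 1) ∣ d ^ p ^ c - 1 := by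
    intro j c hj
    have h := mem_U_iff.1 (hda j)
    rwa [hj, pPow_natCast] at h
  have hlt : ∀ {i j : Fin m} {c c' : ℕ}, i < j → a i = c → a j = c' →
      (∀ hij : (i : ℕ) + ((j : ℕ) - i) < m, 1 ≤ (j : ℕ) - i →
        a ⟨(i : ℕ) + ((j : ℕ) - i), hij⟩ ≠ ⊥ →
        a i + (((j : ℕ) - i : ℕ) : WithBot ℕ) < a ⟨(i : ℕ) + ((j : ℕ) - i), hij⟩) →
      c + ((j : ℕ) - i) < c' := by
    intro i j c c' hij hi hj h
    have hij' := Fin.lt_def.1 hij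
    have hj' : (⟨(i : ℕ) + ((j : ℕ) - i), by omega⟩ : Fin m) = j := Fin.ext (by simp; omega)
    have h1 := h (by omega) (by omega) (by rw [hj', hj]; exact WithBot.coe_ne_bot)
    rw [hj', hi, hj] at h1
    exact_mod_cast h1
  refine ⟨fun _ h => ?_, fun hp2 h1 h2 h3 h4 => ?_⟩ <;>
    refine isIndecomposableModule_of_gapCondition hp hn hm hG hσ ha hd' hda' ⟨?_, ?_⟩
  · intro i j _ hij c c' hi hj
    exact hlt hij hi hj (h i (j - i))
  · intro i j hi0 hij c c' hi hj
    have := hlt hij hi hj (h i (j - i))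
    exact Or.inl (by omega)
  · intro i j hi0 hij c c' hi hj
    exact hlt hij hi hj fun hij hle hbot => h2 i (j - i) hij hle hbot fun hex => hi0 hex.2.1
  · intro i j hi0 hij c c' hi hj
    obtain rfl : i = ⟨0, hm⟩ := Fin.ext hi0
    have hij' : 0 < (j : ℕ) := Fin.lt_def.1 hij
    have hjm := j.isLt
    by_cases hex : d ∉ U 2 2 ∧ a ⟨0, hm⟩ = 0
    · obtain ⟨hd2, ha0⟩ := hex
      have hc0 : c = 0 := by
        rw [ha0] at hi
        exact_mod_cast hi.symm
      have hc' : 1 ≤ c' := by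
        have h5 := h3 hd2 ha0 j hjm hij'
        rw [Nat.one_le_iff_ne_zero]
        rintro rfl
        exact h5 hj
      -- This is where the condition for `n = 1` enters: it excludes `a_0 = 0`.
      have hn2 : 2 ≤ n := by
        by_contra hlt
        have h5 := h1 (by omega)
        rw [ha0] at h5
        exact absurd h5 (by decide)
      refine Or.inr ⟨hp2, hc0, hc', hn2, two_pow_dvd_one_add_mul (hp2 ▸ hd) hd2 hc' ?_⟩
      intro v hv hv1 hv2 hvj
      have h5 := h4 (by omega) ha0 v hv hv1 hv2 j hjm hvj (by rw [hj]; exact WithBot.coe_ne_bot)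
      rw [hj] at h5
      exact_mod_cast h5
    · have := hlt hij hi hj fun hij hle hbot => h2 0 (j - 0) hij hle hbot
        fun h => hex ⟨h.1, h.2.2⟩
      exact Or.inl (by simpa using this)
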